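/- Let $0<a\le b$. There are constants $c,C>0$ and $p\in\mathbb N$, depending only on $a,b$, such that the following holds. For every $n$ let $d=d(n)$, $k=k(n)$ be natural numbers with $d=o(\sqrt n)$ and $k=o(\sqrt n)$ as $n\to\infty$, let $\lambda=\lambda(n)>0$, and let $(x,y)\in\mathbb R^d\times\{-1,1\}$ be a random pair with $x\sim N(0,I_d)$ (the conditional law of $y$ given $x$ is arbitrary) such that, with the logistic loss $\ell(z,y)=\log(1+e^{-yz})$, the minimizer $\theta^\star$ of $\theta\mapsto\mathbb E\,\ell(\langle\theta,x\rangle,y)+\frac\lambda2\|\theta\|_2^2$ over $\mathbb R^d$ satisfies $a\le\|\theta^\star\|_2\le b$. Let $(x_1,y_1),\dots,(x_n,y_n)$ be independent copies of $(x,y)$, put $\ell_i(\theta)=\ell(\langle\theta,x_i\rangle,y_i)+\frac\lambda2\|\theta\|_2^2$, and let $\hat\theta$ be the minimizer over $\mathbb R^d$ of $\sum_{i=1}^n\ell_i(\theta)=\sum_{i=1}^n\ell(\langle\theta,x_i\rangle,y_i)+\frac{n\lambda}2\|\theta\|_2^2$. For a set $T\subseteq[n]$ of $k$ removed samples let $H^T_\theta=\sum_{i\notin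 T}\nabla^2\ell_i(\theta)$, let $C_{\mathrm{Lip}}(T)$ be the least Lipschitz constant on $\mathbb R^d$ of $\theta\mapsto H^T_\theta$ in operator norm, let $C_{\mathrm{op}}(T)=\sup_{\theta\in\mathbb R^d}\|(H^T_\theta)^{-1}\|_{\mathrm{op}}$, and let $C_\ell=\max_{i\in[n]}\|\nabla\ell_i(\hat\theta)\|_2$. The existing (global strong convexity) bound for the error of a single Newton step is, up to an absolute constant factor, $B(T)=C_{\mathrm{Lip}}(T)\,C_{\mathrm{op}}(T)^3\,k^2\,C_\ell^2$. Then, with very high probability over the training set, that is, with probability $1-n^{-\omega(1)}$, all of the following hold: $$\binom nk^{-1}\sum_{T\in\binom{[n]}k}B(T)\;\ge\;c\,\frac{k^2d}{n^2\lambda^3},$$ $$c\,n\le C_{\mathrm{Lip}}(T)\le C\,n\quad\text{and}\quad\frac c{\lambda n}\le C_{\mathrm{op}}(T)\le\frac C{\lambda n}\qquad\text{for all }T\in\tbinom{[n]}k,$$ $$c\sqrt d\le C_\ell\le C(\log n)^p\sqrt d .$$ So the average of the existing bound over $T$ is $\Omega\bigl(k^2d/(n^2\lambda^3)\bigr)$,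 and $C_{\mathrm{Lip}}=\Theta(n)$, $C_{\mathrm{op}}=\Theta(1/(\lambda n))$, $C_\ell=\widetilde\Theta(\sqrt d)$. -/

import Mathlib

open MeasureTheory ProbabilityTheory Filter Asymptotics

noncomputable section

namespace GaussLogReg

/-- The logistic loss `ℓ(z, y) = log (1 + exp (-y z))` of a score `z` and a label `y ∈ {-1, 1}`. -/
def logisticLoss (z y : ℝ) : ℝ := Real.log (1 + Real.exp (-(y * z)))

/-- The regularized loss `ℓ(⟨θ, x⟩, y) + (lam / 2) ‖θ‖²` of one sample `s = (x, y)`. -/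
def sampleLoss {d : ℕ} (lam : ℝ) (s : EuclideanSpace ℝ (Fin d) × ℝ)
    (θ : EuclideanSpace ℝ (Fin d)) : ℝ :=
  logisticLoss (inner ℝ θ s.1) s.2 + lam / 2 * ‖θ‖ ^ 2

/-- The population loss `𝔼 ℓ(⟨θ, x⟩, y) + (lam / 2) ‖θ‖²` for `(x, y)` of law `P`. -/
def populationLoss {d : ℕ} (lam : ℝ) (P : Measure (EuclideanSpace ℝ (Fin d) × ℝ))
    (θ : EuclideanSpace ℝ (Fin d)) : ℝ :=
  ∫ s, logisticLoss (inner ℝ θ s.1) s.2 ∂P + lam / 2 * ‖θ‖ ^ 2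

/-- Agnostic logistic regression with standard Gaussian features, regularization `lam > 0` and
a population optimum whose norm lies in `[a, b]`. The labels may depend on the features in any
way. -/
structure GaussianModel (a b : ℝ) (d : ℕ) (lam : ℝ)
    (P : Measure (EuclideanSpace ℝ (Fin d) × ℝ)) : Prop where
  lam_pos : 0 < lam
  isProbabilityMeasure : IsProbabilityMeasure P
  features : P.map Prod.fst = stdGaussian (EuclideanSpace ℝ (Fin d))
  labels : ∀ᵐ s ∂P, s.2 = 1 ∨ s.2 = -1
  optimum : ∃ θ, IsMinOn (populationLoss lam P) Set.univ θ ∧ a ≤ ‖θ‖ ∧ ‖θ‖ ≤ b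

section Sample

variable {n d : ℕ} (lam : ℝ) (S : Fin n → EuclideanSpace ℝ (Fin d) × ℝ)

/-- The training loss
`L(θ) = ∑ i, ℓ(⟨θ, x i⟩, y i) + (n lam / 2) ‖θ‖²` of the training set `S`. -/
def trainingLoss (θ : EuclideanSpace ℝ (Fin d)) : ℝ :=
  ∑ i, logisticLoss (inner ℝ θ (S i).1) (S i).2 + n * lam / 2 * ‖θ‖ ^ 2

theorem trainingLoss_eq_sum (θ : EuclideanSpace ℝ (Fin d)) :
    trainingLoss lam S θ = ∑ i, sampleLoss lam (S i) θ := by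
  simp only [trainingLoss, sampleLoss, Finset.sum_add_distrib, Finset.sum_const,
    Finset.card_univ, Fintype.card_fin, nsmul_eq_mul]
  ring

/-- The trained model `argmin L` over the whole space. It is unique if `lam > 0` and `n > 0`, see
`existsUnique_isMinOn_trainingLoss`. -/
def trainedModel : EuclideanSpace ℝ (Fin d) :=
  Classical.epsilon fun θ => IsMinOn (trainingLoss lam S) Set.univ θ

/-- The Hessian of a real function, as an operator. -/
def hessian (f : EuclideanSpace ℝ (Fin d) → ℝ) (θ : EuclideanSpace ℝ (Fin d)) :
    EuclideanSpace ℝ (Fin d) →L[ℝ] EuclideanSpace ℝ (Fin d) :=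
  fderiv ℝ (gradient f) θ

/-- The Hessian at `θ` of the loss of the samples that are retained when `T` is removed. -/
def retainedHessian (T : Finset (Fin n)) (θ : EuclideanSpace ℝ (Fin d)) :
    EuclideanSpace ℝ (Fin d) →L[ℝ] EuclideanSpace ℝ (Fin d) :=
  ∑ i ∈ Tᶜ, hessian (sampleLoss lam (S i)) θ

/-- `C_Lip`: the least constant for which the retained Hessian is Lipschitz in operator norm on
the whole space. -/
def cLip (T : Finset (Fin n)) : ℝ :=
  sInf {C : ℝ | 0 ≤ C ∧ ∀ θ θ' : EuclideanSpace ℝ (Fin d),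
    ‖retainedHessian lam S T θ - retainedHessian lam S T θ'‖ ≤ C * ‖θ - θ'‖}

/-- `C_op`: the least bound, over the whole space, for the operator norm of the inverse of the
retained Hessian (which has to be invertible everywhere). -/
def cOp (T : Finset (Fin n)) : ℝ :=
  sInf {C : ℝ | 0 ≤ C ∧ ∀ θ : EuclideanSpace ℝ (Fin d),
    (retainedHessian lam S T θ).IsInvertible ∧ ‖(retainedHessian lam S T θ).inverse‖ ≤ C}

/-- `C_ℓ`: the largest norm of the gradient of the loss of a sample at the trained model. -/
def cGrad : ℝ :=
  ⨆ i : Fin n, ‖gradient (sampleLoss lam (S i)) (trainedModel lam S)‖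

/-- The bound `C_Lip C_op³ k² C_ℓ²` for the error of one Newton step when `T`, of size `k`, is
removed. -/
def existingBound (T : Finset (Fin n)) : ℝ :=
  cLip lam S T * cOp lam S T ^ 3 * (T.card : ℝ) ^ 2 * cGrad lam S ^ 2

/-- The average of the bound over all sets `T` of `k` samples. -/
def averageExistingBound (k : ℕ) : ℝ :=
  (∑ T ∈ Finset.powersetCard k (Finset.univ : Finset (Fin n)), existingBound lam S T) /
    (n.choose k : ℝ)

end Sample

theorem logisticLoss_nonneg (z y : ℝ) : 0 ≤ logisticLoss z y :=
  Real.log_nonneg (by have := Real.exp_pos (-(y * z)); linarith)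

theorem logisticLoss_midpoint (z w y : ℝ) :
    2 * logisticLoss ((z + w) / 2) y ≤ logisticLoss z y + logisticLoss w y := by
  have hz := Real.exp_pos (-(y * z) / 2)
  have hw := Real.exp_pos (-(y * w) / 2)
  have e1 : Real.exp (-(y * z)) = Real.exp (-(y * z) / 2) ^ 2 := by
    rw [← Real.exp_nat_mul]; congr 1; push_cast; ring
  have e2 : Real.exp (-(y * w)) = Real.exp (-(y * w) / 2) ^ 2 := by
    rw [← Real.exp_nat_mul]; congr 1; push_cast; ring
  have e3 : Real.exp (-(y * ((z + w) / 2))) =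
      Real.exp (-(y * z) / 2) * Real.exp (-(y * w) / 2) := by
    rw [← Real.exp_add]; congr 1; ring
  unfold logisticLoss
  rw [← Real.log_mul (by positivity) (by positivity), e1, e2, e3]
  have h : (2 : ℝ) * Real.log (1 + Real.exp (-(y * z) / 2) * Real.exp (-(y * w) / 2)) =
      Real.log ((1 + Real.exp (-(y * z) / 2) * Real.exp (-(y * w) / 2)) ^ 2) := by
    rw [Real.log_pow]; norm_num
  rw [h]
  apply Real.log_le_log (by positivity)
  nlinarith [sq_nonneg (Real.exp (-(y * z) / 2) - Real.exp (-(y * w) / 2))]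

theorem continuous_trainingLoss {n d : ℕ} (lam : ℝ) (S : Fin n → EuclideanSpace ℝ (Fin d) × ℝ) :
    Continuous (trainingLoss lam S) := by
  unfold trainingLoss logisticLoss
  refine Continuous.add (continuous_finsetSum _ fun i _ => ?_) (by fun_prop)
  refine Continuous.log (by fun_prop) fun θ => ?_
  have := Real.exp_pos (-((S i).2 * inner ℝ θ (S i).1))
  positivity

theorem existsUnique_isMinOn_trainingLoss {n d : ℕ} {lam : ℝ} (hlam : 0 < lam) (hn : 0 < n)
    (S : Fin n → EuclideanSpace ℝ (Fin d) × ℝ) :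
    ∃! θ, IsMinOn (trainingLoss lam S) Set.univ θ := by
  have hc : 0 < n * lam / 2 := by positivity
  have hlim : Tendsto (trainingLoss lam S) (cocompact (EuclideanSpace ℝ (Fin d))) atTop := by
    have h1 : Tendsto (fun θ : EuclideanSpace ℝ (Fin d) => n * lam / 2 * ‖θ‖ ^ 2)
        (cocompact _) atTop :=
      Tendsto.const_mul_atTop hc
        ((tendsto_pow_atTop two_ne_zero).comp (tendsto_norm_cocompact_atTop))
    refine tendsto_atTop_mono (fun θ => ?_) h1
    have : 0 ≤ ∑ i, logisticLoss (inner ℝ θ (S i).1) (S i).2 :=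
      Finset.sum_nonneg fun i _ => logisticLoss_nonneg _ _
    unfold trainingLoss
    linarith
  obtain ⟨θ, hθ⟩ := (continuous_trainingLoss lam S).exists_forall_le hlim
  refine ⟨θ, fun x _ => hθ x, fun θ' hθ' => ?_⟩
  have hθ'' : ∀ x, trainingLoss lam S θ' ≤ trainingLoss lam S x := fun x =>
    hθ' (Set.mem_univ x)
  have hm := hθ ((1 / 2 : ℝ) • (θ + θ'))
  have hm' := hθ'' ((1 / 2 : ℝ) • (θ + θ'))
  have hpar := parallelogram_law_with_norm ℝ θ θ'
  have hsum : 2 * ∑ i, logisticLoss (inner ℝ ((1 / 2 : ℝ) • (θ + θ')) (S i).1) (S i).2 ≤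
      ∑ i, logisticLoss (inner ℝ θ (S i).1) (S i).2 +
        ∑ i, logisticLoss (inner ℝ θ' (S i).1) (S i).2 := by
    rw [Finset.mul_sum, ← Finset.sum_add_distrib]
    refine Finset.sum_le_sum fun i _ => ?_
    have := logisticLoss_midpoint (inner ℝ θ (S i).1) (inner ℝ θ' (S i).1) (S i).2
    have e : inner ℝ ((1 / 2 : ℝ) • (θ + θ')) (S i).1 =
        (inner ℝ θ (S i).1 + inner ℝ θ' (S i).1) / 2 := by
      rw [real_inner_smul_left, inner_add_left]
      ring
    rw [e]
    exact this
  have hnorm : ‖(1 / 2 : ℝ) • (θ + θ')‖ ^ 2 = ‖θ + θ'‖ ^ 2 / 4 := by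
    rw [norm_smul, mul_pow]; norm_num; ring
  unfold trainingLoss at hm hm'
  rw [hnorm] at hm hm'
  have h0 : n * lam / 2 * ‖θ - θ'‖ ^ 2 ≤ 0 := by
    have : ‖θ - θ'‖ ^ 2 = 2 * (‖θ‖ ^ 2 + ‖θ'‖ ^ 2) - ‖θ + θ'‖ ^ 2 := by
      nlinarith [hpar]
    rw [this]
    linarith
  have h2 : ‖θ - θ'‖ ^ 2 = 0 := by
    have := sq_nonneg ‖θ - θ'‖
    nlinarith
  exact (sub_eq_zero.mp (norm_eq_zero.mp (pow_eq_zero_iff two_ne_zero |>.mp h2))).symm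

end GaussLogReg

end

noncomputable section

namespace GaussLogReg

/-! ### Nets of the unit sphere -/

/-! Each bound is deterministic once the sample is typical, and typicality is a finite list of
events of superpolynomially small failure probability, with constants that depend on `b` alone. The
retained Hessian is a sum of rank-one terms, weighted by the curvature of the loss at the scores,
plus `|Tᶜ| lam` times the identity.

`C_op`: the rank-one terms are nonnegative, so the inverse has norm at most `1 / (|Tᶜ| lam)`. This
value is approached far out along a coordinate axis: almost surely no sample has a zero coordinate
there, so all curvatures tend to `0` (`le_cOp`). A supremum over the whole space therefore sees
nothing but the regularization.

`C_Lip`: the curvature is a `1`-Lipschitz function of the score, so the upper bound reduces to `∑ i,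
|⟨u, x i⟩| ^ 3 ≤ K n` uniformly over unit vectors `u`. For fixed `u` the truncated cubes satisfy a
Chernoff bound with failure probability `exp (-c √n)`
(`GaussianModel.measureReal_pi_sum_truncated_cube`). A net of size `exp (O(d))` makes it uniform,
and `d = o(√n)` pays for the net. The truncation level `√n / 4` is not reached because `‖x i‖ ≤ log
n * √d`. The lower bound compares the Hessians at `0` and at a basis vector (`le_cLip`).

`C_ℓ`: the upper bound follows from the norms of the features, since stationarity of the trained
model controls `lam θ̂` by the same quantity (`cGrad_le`). For the lower bound, the maximum is at
least the root mean square over the samples, and each of the `d` coordinates contributes a constant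
to the mean square (`le_sum_sq_coordinate`). This requires `‖θ̂‖` to be bounded, so that a constant
fraction of the scores is bounded.

Boundedness of `θ̂`: the population loss rises by a constant from its optimum to every point at
distance `1`, because the first order terms have nonnegative mean and the Bregman divergence of the
logistic loss is bounded below on an event of constant probability. Chernoff and a net transfer the
increase to the training loss (up to the dropped nonnegative quadratic term of the regularization),
and convexity confines the minimizer (`norm_trainedModel_le`). All of this is uniform in `lam`,
since stationarity bounds `lam * ‖θ⋆‖` by a constant.

The lower bounds hold for every `T` of size `k` at once, so their product passes to the average. -/

theorem card_le_of_separated_unitBall {E : Type*} [NormedAddCommGroup E] [NormedSpace ℝ E]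
    [FiniteDimensional ℝ E] {ε : ℝ} (hε : 0 < ε) (s : Finset E) (hs : ∀ c ∈ s, ‖c‖ ≤ 1)
    (h : ∀ c ∈ s, ∀ d ∈ s, c ≠ d → ε ≤ ‖c - d‖) :
    (s.card : ℝ) ≤ (1 + 2 / ε) ^ Module.finrank ℝ E := by
  borelize E
  let μ : Measure E := Measure.addHaar
  have hρ : 0 < 1 + ε / 2 := by positivity
  have hδ : 0 < ε / 2 := by positivity
  have D : Set.Pairwise (s : Set E) (Function.onFun Disjoint fun c => Metric.ball c (ε / 2)) := by
    intro c hc d hd hcd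
    apply Metric.ball_disjoint_ball
    rw [dist_eq_norm, add_halves]
    exact h c hc d hd hcd
  have hsub : (⋃ c ∈ s, Metric.ball c (ε / 2)) ⊆ Metric.ball (0 : E) (1 + ε / 2) := by
    refine Set.iUnion₂_subset fun x hx => Metric.ball_subset_ball' ?_
    rw [dist_zero_right, add_comm]
    exact add_le_add (hs x hx) le_rfl
  have I : (s.card : ENNReal) * ENNReal.ofReal ((ε / 2) ^ Module.finrank ℝ E) *
      μ (Metric.ball 0 1) ≤
      ENNReal.ofReal ((1 + ε / 2) ^ Module.finrank ℝ E) * μ (Metric.ball 0 1) :=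
    calc
      _ = μ (⋃ c ∈ s, Metric.ball c (ε / 2)) := by
        rw [measure_biUnion_finset D fun c _ => measurableSet_ball]
        simp only [μ.addHaar_ball_of_pos _ hδ, Finset.sum_const, nsmul_eq_mul, mul_assoc]
      _ ≤ μ (Metric.ball (0 : E) (1 + ε / 2)) := measure_mono hsub
      _ = _ := by simp only [μ.addHaar_ball_of_pos _ hρ]
  have J := (ENNReal.mul_le_mul_iff_left (Metric.measure_ball_pos _ _ zero_lt_one).ne'
    measure_ball_lt_top.ne).1 I
  have K := ENNReal.toReal_le_of_le_ofReal (pow_nonneg hρ.le _) J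
  rw [ENNReal.toReal_mul, ENNReal.toReal_natCast,
    ENNReal.toReal_ofReal (pow_nonneg hδ.le _)] at K
  have e : (1 + 2 / ε) = (1 + ε / 2) / (ε / 2) := by field_simp; ring
  rw [e, div_pow, le_div_iff₀ (pow_pos hδ _)]
  exact K

/-- A largest `ε`-separated subset of the sphere is an `ε`-net, since a point far from all its
members could be added. Comparing volumes bounds the size of separated sets, so a largest one
exists. -/
theorem exists_net_unitSphere {E : Type*} [NormedAddCommGroup E] [NormedSpace ℝ E]
    [FiniteDimensional ℝ E] {ε : ℝ} (hε : 0 < ε) :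
    ∃ N : Finset E, (∀ u ∈ N, ‖u‖ = 1) ∧ (∀ u, ‖u‖ = 1 → ∃ v ∈ N, ‖u - v‖ ≤ ε) ∧
      (N.card : ℝ) ≤ (1 + 2 / ε) ^ Module.finrank ℝ E := by
  classical
  let p : ℕ → Prop := fun m => ∃ s : Finset E, s.card = m ∧ (∀ u ∈ s, ‖u‖ = 1) ∧
    ∀ c ∈ s, ∀ d ∈ s, c ≠ d → ε ≤ ‖c - d‖
  let m := Nat.findGreatest p ⌊(1 + 2 / ε) ^ Module.finrank ℝ E⌋₊
  have hb : ∀ k, p k → k ≤ ⌊(1 + 2 / ε) ^ Module.finrank ℝ E⌋₊ := by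
    rintro k ⟨s, rfl, h1, h2⟩
    exact Nat.le_floor (card_le_of_separated_unitBall hε s (fun c hc => (h1 c hc).le) h2)
  have hp0 : p 0 := ⟨∅, by simp⟩
  obtain ⟨s, hsc, h1, h2⟩ : p m := Nat.findGreatest_spec (Nat.zero_le _) hp0
  refine ⟨s, h1, fun u hu => ?_, card_le_of_separated_unitBall hε s (fun c hc => (h1 c hc).le) h2⟩
  by_contra! hcon
  have hus : u ∉ s := fun hmem => by
    have := hcon u hmem
    simp at this
    linarith
  have hp1 : p (m + 1) := by
    refine ⟨insert u s, by rw [Finset.card_insert_of_notMem hus, hsc], ?_, ?_⟩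
    · simpa [hu] using h1
    · intro c hc d hd hcd
      rcases Finset.mem_insert.1 hc with hcu | hcs <;> rcases Finset.mem_insert.1 hd with hdu | hds
      · exact absurd (hcu.trans hdu.symm) hcd
      · rw [hcu]; exact (hcon d hds).le
      · rw [hdu, norm_sub_rev]; exact (hcon c hcs).le
      · exact h2 c hcs d hds hcd
  have := Nat.le_findGreatest (hb _ hp1) hp1
  change m + 1 ≤ m at this
  omega

/-! ### Exponential moment bounds for sums of independent copies -/

/-- Chernoff's bound, with the tilting parameter absorbed into `f`. -/
theorem measureReal_pi_sum_ge_le {α : Type*} [MeasurableSpace α] (P : Measure α)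
    [IsProbabilityMeasure P] (n : ℕ) {f : α → ℝ} {A t : ℝ}
    (hI : Integrable (fun s => Real.exp (f s)) P)
    (h : ∫ s, Real.exp (f s) ∂P ≤ Real.exp A) :
    (Measure.pi fun _ : Fin n => P).real {S | t ≤ ∑ i, f (S i)} ≤ Real.exp (n * A - t) := by
  have e : (fun S : Fin n → α => Real.exp (1 * ∑ i, f (S i))) =
      fun S => ∏ i, Real.exp (f (S i)) := by
    ext S; rw [one_mul, Real.exp_sum]
  have hint : Integrable (fun S : Fin n → α => Real.exp (1 * ∑ i, f (S i)))
      (Measure.pi fun _ : Fin n => P) := by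
    rw [e]
    exact Integrable.fintype_prod (f := fun _ => fun s => Real.exp (f s)) (fun _ => hI)
  have := measure_ge_le_exp_mul_mgf (μ := Measure.pi fun _ : Fin n => P)
    (X := fun S => ∑ i, f (S i)) t zero_le_one hint
  refine this.trans ?_
  rw [mgf, e, integral_fintype_prod_eq_pow (μ := P) (fun s => Real.exp (f s)),
    Fintype.card_fin, sub_eq_neg_add, Real.exp_add]
  have h0 : 0 ≤ ∫ s, Real.exp (f s) ∂P := integral_nonneg fun s => (Real.exp_pos _).le
  have := pow_le_pow_left₀ h0 h n
  rw [← Real.exp_nat_mul] at this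
  simpa using mul_le_mul_of_nonneg_left this (Real.exp_pos (-t)).le

theorem measureReal_pi_exists_le {α : Type*} [MeasurableSpace α] (P : Measure α)
    [IsProbabilityMeasure P] (n : ℕ) (B : Set α) :
    (Measure.pi fun _ : Fin n => P).real {S | ∃ i, S i ∈ B} ≤ n * P.real B := by
  have e : {S : Fin n → α | ∃ i, S i ∈ B} = ⋃ i ∈ (Finset.univ : Finset (Fin n)),
      Function.eval i ⁻¹' B := by
    ext S; simp
  rw [e]
  refine (measureReal_biUnion_finset_le _ _).trans ?_
  have : ∀ i ∈ (Finset.univ : Finset (Fin n)),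
      (Measure.pi fun _ : Fin n => P).real (Function.eval i ⁻¹' B) ≤ P.real B := by
    intro i _
    have hm := measurePreserving_eval (fun _ : Fin n => P) i
    refine ENNReal.toReal_mono (measure_ne_top _ _) ?_
    -- `B` need not be measurable, so its preimage is compared with that of a measurable hull.
    calc _ ≤ (Measure.pi fun _ : Fin n => P) (Function.eval i ⁻¹' toMeasurable P B) :=
          measure_mono (Set.preimage_mono (subset_toMeasurable _ _))
      _ = P (toMeasurable P B) := hm.measure_preimage (measurableSet_toMeasurable _ _).nullMeasurableSet
      _ = P B := measure_toMeasurable _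
  refine (Finset.sum_le_card_nsmul _ _ _ this).trans ?_
  simp

/-- Lower tail of a sum of independent copies of a variable with values in `[0, 1]`. -/
theorem measureReal_pi_sum_le_le {α : Type*} [MeasurableSpace α] (P : Measure α)
    [IsProbabilityMeasure P] (n : ℕ) {W : α → ℝ} {μ : ℝ} (hW : AEStronglyMeasurable W P)
    (h0 : ∀ s, 0 ≤ W s) (h1 : ∀ s, W s ≤ 1) (hμ : μ ≤ ∫ s, W s ∂P) :
    (Measure.pi fun _ : Fin n => P).real {S | ∑ i, W (S i) ≤ n * (μ / 4)} ≤
      Real.exp (-(n * (μ / 4))) := by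
  have hWi : Integrable W P := by
    refine Integrable.of_bound hW 1 (ae_of_all _ fun s => ?_)
    rw [Real.norm_eq_abs, abs_of_nonneg (h0 s)]
    exact h1 s
  -- Each factor contributes `exp (-μ / 2)`; Markov's inequality at the level `n μ / 4` gives back
  -- half of the exponent.
  have hexp : ∀ x : ℝ, 0 ≤ x → x ≤ 1 → Real.exp (-x) ≤ 1 - x / 2 := by
    intro x hx0 hx1
    have hq := Real.quadratic_le_exp_of_nonneg hx0
    rw [Real.exp_neg, inv_le_iff_one_le_mul₀ (Real.exp_pos _)]
    nlinarith [mul_nonneg hx0 hx0, mul_nonneg hx0 (sub_nonneg.2 hx1),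
      mul_nonneg (mul_nonneg hx0 hx0) (sub_nonneg.2 hx1)]
  have hI : Integrable (fun s => Real.exp (-W s)) P := by
    refine Integrable.of_bound
      (Real.continuous_exp.comp_aestronglyMeasurable hW.neg) 1 (ae_of_all _ fun s => ?_)
    rw [Real.norm_eq_abs, Real.abs_exp, Real.exp_le_one_iff]
    linarith [h0 s]
  have hle : ∫ s, Real.exp (-W s) ∂P ≤ Real.exp (-(μ / 2)) := by
    calc _ ≤ ∫ s, (1 - W s / 2) ∂P :=
          integral_mono hI ((integrable_const _).sub (hWi.div_const 2))
            fun s => hexp _ (h0 s) (h1 s)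
      _ = 1 - (∫ s, W s ∂P) / 2 := by
          rw [integral_sub (integrable_const _) (hWi.div_const 2), integral_div]; simp
      _ ≤ 1 - μ / 2 := by linarith
      _ ≤ _ := by linarith [Real.add_one_le_exp (-(μ / 2))]
  have := measureReal_pi_sum_ge_le P n (t := -(n * (μ / 4))) hI hle
  have e : {S : Fin n → α | ∑ i, W (S i) ≤ n * (μ / 4)} =
      {S | -(n * (μ / 4)) ≤ ∑ i, -W (S i)} := by
    ext S; simp
  rw [e]
  refine this.trans (Real.exp_le_exp.2 (by linarith))

/-! ### The standard Gaussian on the line -/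

/-- Any coefficient below `1 / 2` is integrable. The choice `3 / 8 = 1 / 4 + 1 / 8` leaves `1 / 4`
for an exponential factor and `1 / 8` for a polynomial one, in `abs_add_sq_mul_exp_le` and in the
truncated cubes. -/
theorem integrable_exp_sq_gaussianReal :
    Integrable (fun x : ℝ => Real.exp (3 / 8 * x ^ 2)) (gaussianReal 0 1) := by
  rw [gaussianReal_of_var_ne_zero _ one_ne_zero]
  rw [integrable_withDensity_iff_integrable_smul' (measurable_gaussianPDF _ _)
    (ae_of_all _ fun x => gaussianPDF_lt_top)]
  simp only [toReal_gaussianPDF, gaussianPDFReal, smul_eq_mul]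
  refine ((integrable_exp_neg_mul_sq (b := 1 / 8) (by norm_num)).const_mul
    (√(2 * Real.pi * ((1 : NNReal) : ℝ)))⁻¹).congr (ae_of_all _ fun x => ?_)
  simp only [mul_assoc, ← Real.exp_add]
  congr 2
  simp; ring

theorem gaussianPDFReal_le_one (x : ℝ) : gaussianPDFReal 0 1 x ≤ 1 := by
  have h : (1 : ℝ) ≤ √(2 * Real.pi * ((1 : NNReal) : ℝ)) := by
    rw [Real.one_le_sqrt]
    have := Real.pi_gt_three
    simp; linarith
  rw [gaussianPDFReal]
  refine mul_le_one₀ (inv_le_one_of_one_le₀ h) (Real.exp_pos _).le ?_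
  rw [Real.exp_le_one_iff]
  have : 0 ≤ (x - 0) ^ 2 / (2 * ((1 : NNReal) : ℝ)) := by positivity
  rw [neg_div]
  linarith

theorem gaussianReal_abs_lt_le {δ : ℝ} (hδ : 0 ≤ δ) :
    (gaussianReal 0 1).real {x | |x| < δ} ≤ 2 * δ := by
  have e : {x : ℝ | |x| < δ} = Set.Ioo (-δ) δ := by ext x; simp [abs_lt]
  refine ENNReal.toReal_le_of_le_ofReal (by positivity) ?_
  rw [gaussianReal_apply _ one_ne_zero, e]
  calc _ ≤ ∫⁻ x in Set.Ioo (-δ) δ, 1 := by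
        refine lintegral_mono fun x => ?_
        rw [gaussianPDF, ENNReal.ofReal_le_one]
        exact gaussianPDFReal_le_one x
    _ = _ := by rw [lintegral_one, Measure.restrict_apply_univ, Real.volume_Ioo]; congr 1; ring

theorem gaussianReal_abs_le_pos {δ : ℝ} (hδ : 0 < δ) :
    0 < (gaussianReal 0 1).real {x | |x| ≤ δ} := by
  have e : {x : ℝ | |x| ≤ δ} = Set.Icc (-δ) δ := by ext x; simp [abs_le]
  refine ENNReal.toReal_pos (fun h => ?_) (measure_ne_top _ _)
  have := gaussianReal_absolutelyContinuous' 0 one_ne_zero h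
  rw [e, Real.volume_Icc, ENNReal.ofReal_eq_zero] at this
  linarith

section Marginals

/-! ### Marginals of the features -/

theorem stdGaussian_map_inner {d : ℕ} {u : EuclideanSpace ℝ (Fin d)} (hu : ‖u‖ = 1) :
    (stdGaussian (EuclideanSpace ℝ (Fin d))).map (fun x => inner ℝ u x) = gaussianReal 0 1 := by
  have h1 := IsGaussian.map_eq_gaussianReal (μ := stdGaussian (EuclideanSpace ℝ (Fin d)))
    (innerSL ℝ u)
  rw [integral_strongDual_stdGaussian, variance_dual_stdGaussian, innerSL_apply_norm, hu] at h1
  simpa using h1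

variable {a b lam : ℝ} {d : ℕ} {P : Measure (EuclideanSpace ℝ (Fin d) × ℝ)}

theorem GaussianModel.map_inner (h : GaussianModel a b d lam P) {u : EuclideanSpace ℝ (Fin d)}
    (hu : ‖u‖ = 1) :
    P.map (fun s => inner ℝ u s.1) = gaussianReal 0 1 := by
  rw [← stdGaussian_map_inner hu, ← h.features, Measure.map_map (by fun_prop) (by fun_prop)]
  rfl

end Marginals

section Loss

/-! ### The logistic loss -/

theorem hasDerivAt_logisticLoss (z y : ℝ) :
    HasDerivAt (fun z => logisticLoss z y) (-(y * Real.sigmoid (-(y * z)))) z := by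
  have h1 : HasDerivAt (fun z : ℝ => -(y * z)) (-y) z := by
    simpa only [neg_mul, mul_one] using (hasDerivAt_id' z).const_mul (-y)
  have h2 : HasDerivAt (fun z : ℝ => 1 + Real.exp (-(y * z))) (Real.exp (-(y * z)) * -y) z :=
    h1.exp.const_add 1
  have h3 := h2.log (by positivity)
  convert! h3 using 1
  rw [← Real.sigmoid_mul_rexp_neg, Real.sigmoid_def]
  field_simp

/-- The Bregman divergence of the logistic loss. -/
def logisticBregman (z h y : ℝ) : ℝ :=
  logisticLoss (z + h) y - logisticLoss z y + y * Real.sigmoid (-(y * z)) * h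

/-- With `p = sigmoid (-(y z))` the divergence is the centred log moment generating function of a
Bernoulli variable of mean `p`. Its sign is then Jensen's inequality for `exp`, and upper bounds
follow from `log x ≤ x - 1`. -/
theorem logisticBregman_eq (z h y : ℝ) :
    logisticBregman z h y =
      Real.log (1 - Real.sigmoid (-(y * z)) + Real.sigmoid (-(y * z)) * Real.exp (-(y * h))) +
        Real.sigmoid (-(y * z)) * (y * h) := by
  have hz := Real.exp_pos (-(y * z))
  have e : 1 - Real.sigmoid (-(y * z)) + Real.sigmoid (-(y * z)) * Real.exp (-(y * h)) =
      (1 + Real.exp (-(y * (z + h)))) / (1 + Real.exp (-(y * z))) := by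
    have e1 : 1 - Real.sigmoid (-(y * z)) = (1 + Real.exp (-(y * z)))⁻¹ := by
      rw [Real.sigmoid_neg, Real.sigmoid_def]; ring
    have e2 : Real.sigmoid (-(y * z)) = Real.exp (-(y * z)) / (1 + Real.exp (-(y * z))) := by
      rw [← Real.sigmoid_mul_rexp_neg, Real.sigmoid_def]; field_simp
    have e3 : Real.exp (-(y * (z + h))) = Real.exp (-(y * z)) * Real.exp (-(y * h)) := by
      rw [← Real.exp_add]; congr 1; ring
    rw [e1, e2, e3]
    field_simp
  rw [e, Real.log_div (by positivity) (by positivity), logisticBregman, logisticLoss,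
    logisticLoss]
  ring

theorem exp_neg_mul_le_of_mem_Icc {p t : ℝ} (h0 : 0 < p) (h1 : p < 1) :
    Real.exp (-(p * t)) ≤ 1 - p + p * Real.exp (-t) := by
  have := convexOn_exp.2 (Set.mem_univ (0 : ℝ)) (Set.mem_univ (-t)) (sub_pos.2 h1).le h0.le
    (by ring)
  simpa using this

theorem exp_neg_mul_lt_of_mem_Ioo {p t : ℝ} (h0 : 0 < p) (h1 : p < 1) (ht : t ≠ 0) :
    Real.exp (-(p * t)) < 1 - p + p * Real.exp (-t) := by
  have := strictConvexOn_exp.2 (Set.mem_univ (0 : ℝ)) (Set.mem_univ (-t)) (by simpa using (neg_ne_zero.2 ht).symm)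
    (sub_pos.2 h1) h0 (by ring)
  simpa using this

theorem logisticBregman_nonneg (z h y : ℝ) : 0 ≤ logisticBregman z h y := by
  rw [logisticBregman_eq]
  have := exp_neg_mul_le_of_mem_Icc (t := y * h) (Real.sigmoid_pos (-(y * z)))
    (Real.sigmoid_lt_one _)
  have := Real.log_le_log (Real.exp_pos _) this
  rw [Real.log_exp] at this
  linarith

theorem logisticBregman_pos (z : ℝ) {h y : ℝ} (hh : h ≠ 0) (hy : y ≠ 0) :
    0 < logisticBregman z h y := by
  rw [logisticBregman_eq]
  have := exp_neg_mul_lt_of_mem_Ioo (Real.sigmoid_pos (-(y * z)))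
    (Real.sigmoid_lt_one _) (mul_ne_zero hy hh)
  have := Real.log_lt_log (Real.exp_pos _) this
  rw [Real.log_exp] at this
  linarith

theorem exp_le_one_add_add (x : ℝ) : Real.exp x ≤ 1 + x + x ^ 2 * Real.exp |x| := by
  have h2 : ∀ t : ℝ, Real.exp t - 1 ≤ |t| * Real.exp |t| := by
    intro t
    have h1 := Real.one_sub_le_exp_neg t
    have h3 : Real.exp t * Real.exp (-t) = 1 := by rw [← Real.exp_add]; simp
    have h4 : Real.exp t - 1 ≤ t * Real.exp t := by nlinarith [Real.exp_pos t]
    refine h4.trans ?_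
    exact mul_le_mul (le_abs_self t) (Real.exp_le_exp.2 (le_abs_self t)) (Real.exp_pos _).le
      (abs_nonneg _)
  rcases le_total 0 x with hx | hx
  · have h1 := Real.one_sub_le_exp_neg x
    have h3 : Real.exp x * Real.exp (-x) = 1 := by rw [← Real.exp_add]; simp
    have h4 : Real.exp x - 1 ≤ x * Real.exp x := by nlinarith [Real.exp_pos x]
    rw [abs_of_nonneg hx]
    nlinarith
  · have h1 := Real.one_sub_le_exp_neg x
    have h3 : Real.exp x * Real.exp (-x) = 1 := by rw [← Real.exp_add]; simp
    have h4 : Real.exp x - 1 ≤ x * Real.exp x := by nlinarith [Real.exp_pos x]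
    have h5 := Real.add_one_le_exp x
    have h6 : (1 : ℝ) ≤ Real.exp |x| := Real.one_le_exp (abs_nonneg _)
    nlinarith [sq_nonneg x]

theorem logisticBregman_le {z h y : ℝ} (hy : |y| = 1) :
    logisticBregman z h y ≤ h ^ 2 * Real.exp |h| := by
  rw [logisticBregman_eq]
  set p := Real.sigmoid (-(y * z))
  have hp0 : 0 < p := Real.sigmoid_pos _
  have hp1 : p < 1 := Real.sigmoid_lt_one _
  have hpos : 0 < 1 - p + p * Real.exp (-(y * h)) := by
    have := mul_pos hp0 (Real.exp_pos (-(y * h))); linarith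
  have h1 := Real.log_le_sub_one_of_pos hpos
  have h2 := exp_le_one_add_add (-(y * h))
  have h3 : |-(y * h)| = |h| := by rw [abs_neg, abs_mul, hy, one_mul]
  have h4 : (-(y * h)) ^ 2 = h ^ 2 := by rw [← sq_abs, h3, sq_abs]
  rw [h3, h4] at h2
  have h5 : 0 ≤ h ^ 2 * Real.exp |h| := by positivity
  nlinarith

theorem logisticLoss_tangent_le (z w y : ℝ) :
    logisticLoss z y - y * Real.sigmoid (-(y * z)) * (w - z) ≤ logisticLoss w y := by
  have := logisticBregman_nonneg z (w - z) y
  rw [logisticBregman, add_sub_cancel] at this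
  linarith

theorem abs_mul_sigmoid_le {y : ℝ} (hy : |y| = 1) (w : ℝ) : |y * Real.sigmoid w| ≤ 1 := by
  rw [abs_mul, hy, one_mul, abs_of_pos (Real.sigmoid_pos w)]
  exact Real.sigmoid_le_one w

theorem abs_logisticLoss_sub_le {y : ℝ} (hy : |y| = 1) (z w : ℝ) :
    |logisticLoss z y - logisticLoss w y| ≤ |z - w| := by
  have key : ∀ z w : ℝ, logisticLoss z y - logisticLoss w y ≤ |z - w| := by
    intro z w
    have h1 := logisticLoss_tangent_le z w y
    have h2 : y * Real.sigmoid (-(y * z)) * (w - z) ≤ |z - w| := by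
      refine (le_abs_self _).trans ?_
      rw [abs_mul, abs_sub_comm w z]
      exact mul_le_of_le_one_left (abs_nonneg _) (abs_mul_sigmoid_le hy _)
    linarith
  exact abs_sub_le_iff.2 ⟨key z w, by rw [abs_sub_comm]; exact key w z⟩

@[fun_prop]
theorem continuous_logisticLoss : Continuous fun p : ℝ × ℝ => logisticLoss p.1 p.2 := by
  unfold logisticLoss
  refine Continuous.log (by fun_prop) fun p => ?_
  have := Real.exp_pos (-(p.2 * p.1))
  positivity

theorem _root_.Continuous.logisticLoss {X : Type*} [TopologicalSpace X] {f g : X → ℝ}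
    (hf : Continuous f) (hg : Continuous g) : Continuous fun x => logisticLoss (f x) (g x) :=
  continuous_logisticLoss.comp (hf.prodMk hg)

theorem _root_.Continuous.realSigmoid {X : Type*} [TopologicalSpace X] {f : X → ℝ}
    (hf : Continuous f) : Continuous fun x => Real.sigmoid (f x) :=
  continuous_sigmoid.comp hf

theorem continuous_logisticBregman {X : Type*} [TopologicalSpace X] {f g k : X → ℝ}
    (hf : Continuous f) (hg : Continuous g) (hk : Continuous k) :
    Continuous fun x => logisticBregman (f x) (g x) (k x) := by
  unfold logisticBregman
  exact (((hf.add hg).logisticLoss hk).sub (hf.logisticLoss hk)).add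
    ((hk.mul (hk.mul hf).neg.realSigmoid).mul hg)

/-- A positive continuous function on a compact set; `δ` keeps `h` away from `0`, where the
divergence vanishes. -/
theorem exists_logisticBregman_lower_bound (M δ : ℝ) (hδ : 0 < δ) :
    ∃ c > 0, ∀ z h y : ℝ, |z| ≤ M → δ ≤ |h| → |h| ≤ M → |y| = 1 → c ≤ logisticBregman z h y := by
  let K : Set (ℝ × ℝ × ℝ) := {q | |q.1| ≤ M ∧ δ ≤ |q.2.1| ∧ |q.2.1| ≤ M ∧ |q.2.2| = 1}
  have hKc : IsClosed K := by
    have h1 : Continuous fun q : ℝ × ℝ × ℝ => |q.1| := by fun_prop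
    have h2 : Continuous fun q : ℝ × ℝ × ℝ => |q.2.1| := by fun_prop
    have h3 : Continuous fun q : ℝ × ℝ × ℝ => |q.2.2| := by fun_prop
    exact (isClosed_le h1 continuous_const).inter ((isClosed_le continuous_const h2).inter
      ((isClosed_le h2 continuous_const).inter (isClosed_eq h3 continuous_const)))
  have hK : IsCompact K := by
    refine Metric.isCompact_of_isClosed_isBounded hKc
      ((Metric.isBounded_closedBall (x := (0 : ℝ × ℝ × ℝ)) (r := max M 1)).subset ?_)
    rintro ⟨z, h, y⟩ ⟨h1, _, h3, h4⟩
    simp only [mem_closedBall_zero_iff, Prod.norm_def, Real.norm_eq_abs, sup_le_iff]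
    exact ⟨h1.trans (le_max_left _ _), h3.trans (le_max_left _ _), h4.le.trans (le_max_right _ _)⟩
  rcases K.eq_empty_or_nonempty with hE | hE
  · refine ⟨1, one_pos, fun z h y h1 h2 h3 h4 => ?_⟩
    have : (z, h, y) ∈ K := ⟨h1, h2, h3, h4⟩
    rw [hE] at this
    exact this.elim
  · obtain ⟨q, hq, hmin⟩ := hK.exists_isMinOn hE
      (continuous_logisticBregman (f := fun q : ℝ × ℝ × ℝ => q.1) (g := fun q => q.2.1)
        (k := fun q => q.2.2) (by fun_prop) (by fun_prop) (by fun_prop)).continuousOn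
    refine ⟨_, logisticBregman_pos q.1 (h := q.2.1) (y := q.2.2) ?_ ?_, fun z h y h1 h2 h3 h4 =>
      hmin (a := (z, h, y)) ⟨h1, h2, h3, h4⟩⟩
    · exact abs_pos.1 (hδ.trans_le hq.2.1)
    · exact abs_pos.1 (by rw [hq.2.2.2]; exact one_pos)

/-! ### Gradient and Hessian of the loss of a sample -/

variable {d : ℕ}

theorem hasGradientAt_sampleLoss (lam : ℝ) (s : EuclideanSpace ℝ (Fin d) × ℝ)
    (θ : EuclideanSpace ℝ (Fin d)) :
    HasGradientAt (sampleLoss lam s)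
      (-(s.2 * Real.sigmoid (-(s.2 * inner ℝ θ s.1))) • s.1 + lam • θ) θ := by
  rw [hasGradientAt_iff_hasFDerivAt]
  have h1 : HasFDerivAt (fun θ : EuclideanSpace ℝ (Fin d) => inner ℝ θ s.1)
      (innerSL ℝ s.1) θ := by
    have := (innerSL ℝ s.1).hasFDerivAt (x := θ)
    refine this.congr_of_eventuallyEq (Eventually.of_forall fun θ' => ?_)
    simp [real_inner_comm]
  have h2 := (hasDerivAt_logisticLoss (inner ℝ θ s.1) s.2).comp_hasFDerivAt θ h1
  have h3 := ((hasStrictFDerivAt_norm_sq θ).hasFDerivAt).const_mul (lam / 2)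
  refine (h2.add h3).congr_fderiv ?_
  ext v
  simp
  ring

theorem gradient_sampleLoss (lam : ℝ) (s : EuclideanSpace ℝ (Fin d) × ℝ)
    (θ : EuclideanSpace ℝ (Fin d)) :
    gradient (sampleLoss lam s) θ =
      -(s.2 * Real.sigmoid (-(s.2 * inner ℝ θ s.1))) • s.1 + lam • θ :=
  (hasGradientAt_sampleLoss lam s θ).gradient

/-- The second derivative of the logistic loss with respect to the score. -/
def logisticCurvature (z y : ℝ) : ℝ :=
  y ^ 2 * (Real.sigmoid (-(y * z)) * (1 - Real.sigmoid (-(y * z))))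

theorem hessian_sampleLoss (lam : ℝ) (s : EuclideanSpace ℝ (Fin d) × ℝ)
    (θ : EuclideanSpace ℝ (Fin d)) :
    hessian (sampleLoss lam s) θ =
      logisticCurvature (inner ℝ θ s.1) s.2 • (innerSL ℝ s.1).smulRight s.1 +
        lam • ContinuousLinearMap.id ℝ _ := by
  have e : gradient (sampleLoss lam s) = fun θ =>
      -(s.2 * Real.sigmoid (-(s.2 * inner ℝ θ s.1))) • s.1 + lam • θ :=
    funext fun θ => gradient_sampleLoss lam s θ
  have h1 : HasFDerivAt (fun θ : EuclideanSpace ℝ (Fin d) => inner ℝ θ s.1)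
      (innerSL ℝ s.1) θ := by
    have := (innerSL ℝ s.1).hasFDerivAt (x := θ)
    refine this.congr_of_eventuallyEq (Eventually.of_forall fun θ' => ?_)
    simp [real_inner_comm]
  have h0 : HasDerivAt (fun z : ℝ => -(s.2 * z)) (-s.2) (inner ℝ θ s.1) := by
    simpa only [neg_mul, mul_one] using (hasDerivAt_id' (inner ℝ θ s.1)).const_mul (-s.2)
  have h2 : HasDerivAt (fun z : ℝ => -(s.2 * Real.sigmoid (-(s.2 * z))))
      (logisticCurvature (inner ℝ θ s.1) s.2) (inner ℝ θ s.1) := by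
    have := (((Real.hasDerivAt_sigmoid (-(s.2 * inner ℝ θ s.1))).comp (inner ℝ θ s.1) h0).const_mul s.2).neg
    refine this.congr_deriv ?_
    rw [logisticCurvature]; ring
  have h3 := (h2.comp_hasFDerivAt θ h1).smul_const s.1
  have h4 := h3.add ((hasFDerivAt_id θ).const_smul lam)
  rw [hessian, e]
  refine h4.fderiv.trans ?_
  ext v
  simp [mul_smul]

end Loss

section Deterministic

/-! ### The curvature of the logistic loss -/

/-- Completing the square shows that the curvature is largest at score `0` and decreases with the
distance of the sigmoid from `1 / 2`. -/
theorem logisticCurvature_eq {y : ℝ} (hy : |y| = 1) (z : ℝ) :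
    logisticCurvature z y = 1 / 4 - (Real.sigmoid (-(y * z)) - 1 / 2) ^ 2 := by
  rw [logisticCurvature, ← sq_abs, hy]; ring

theorem logisticCurvature_nonneg (z y : ℝ) : 0 ≤ logisticCurvature z y :=
  mul_nonneg (sq_nonneg _) (mul_nonneg (Real.sigmoid_nonneg _)
    (sub_nonneg.2 (Real.sigmoid_le_one _)))

theorem logisticCurvature_zero {y : ℝ} (hy : |y| = 1) : logisticCurvature 0 y = 1 / 4 := by
  rw [logisticCurvature_eq hy]; simp [Real.sigmoid_zero]

theorem abs_sigmoid_sub_le (z w : ℝ) : |Real.sigmoid z - Real.sigmoid w| ≤ |z - w| := by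
  have := (convex_univ (𝕜 := ℝ) (E := ℝ)).norm_image_sub_le_of_norm_deriv_le (f := Real.sigmoid)
    (C := 1) (x := w) (y := z) (fun x _ => differentiable_sigmoid x) (fun x _ => by
      rw [Real.deriv_sigmoid, Real.norm_eq_abs, abs_of_nonneg]
      · nlinarith [Real.sigmoid_pos x, Real.sigmoid_lt_one x]
      · nlinarith [Real.sigmoid_pos x, Real.sigmoid_lt_one x]) (Set.mem_univ _) (Set.mem_univ _)
  simpa using this

theorem abs_logisticCurvature_sub_le {y : ℝ} (hy : |y| = 1) (z w : ℝ) :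
    |logisticCurvature z y - logisticCurvature w y| ≤ |z - w| := by
  rw [logisticCurvature_eq hy, logisticCurvature_eq hy]
  set s := Real.sigmoid (-(y * z)) with hs
  set t := Real.sigmoid (-(y * w)) with ht
  have e : 1 / 4 - (s - 1 / 2) ^ 2 - (1 / 4 - (t - 1 / 2) ^ 2) = (s - t) * (1 - s - t) := by ring
  have h1 : |1 - s - t| ≤ 1 := by
    rw [abs_le]
    constructor <;>
      linarith [Real.sigmoid_pos (-(y * z)), Real.sigmoid_lt_one (-(y * z)),
        Real.sigmoid_pos (-(y * w)), Real.sigmoid_lt_one (-(y * w))]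
  have h2 : |s - t| ≤ |z - w| := by
    refine (abs_sigmoid_sub_le _ _).trans (le_of_eq ?_)
    rw [show -(y * z) - -(y * w) = -(y * (z - w)) by ring, abs_neg, abs_mul, hy, one_mul]
  rw [e, abs_mul]
  nlinarith [abs_nonneg (s - t), abs_nonneg (1 - s - t)]

theorem sq_le_sq_sigmoid_sub_half {δ w : ℝ} (hδ : 0 ≤ δ) (hw : δ ≤ |w|) :
    (Real.sigmoid δ - 1 / 2) ^ 2 ≤ (Real.sigmoid w - 1 / 2) ^ 2 := by
  have h0 : (1 / 2 : ℝ) ≤ Real.sigmoid δ := by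
    have := Real.sigmoid_le hδ; rw [Real.sigmoid_zero] at this; linarith
  rcases le_abs.1 hw with h | h
  · have := Real.sigmoid_le h
    exact pow_le_pow_left₀ (by linarith) (by linarith) 2
  · have := Real.sigmoid_le h
    rw [Real.sigmoid_neg] at this
    have h3 := pow_le_pow_left₀ (by linarith : 0 ≤ Real.sigmoid δ - 1 / 2)
      (by linarith : _ ≤ 1 / 2 - Real.sigmoid w) 2
    nlinarith

theorem logisticCurvature_le {y : ℝ} (hy : |y| = 1) {δ z : ℝ} (hδ : 0 ≤ δ) (hz : δ ≤ |z|) :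
    logisticCurvature z y ≤ 1 / 4 - (Real.sigmoid δ - 1 / 2) ^ 2 := by
  rw [logisticCurvature_eq hy]
  have : δ ≤ |-(y * z)| := by rwa [abs_neg, abs_mul, hy, one_mul]
  linarith [sq_le_sq_sigmoid_sub_half hδ this]

theorem tendsto_logisticCurvature {y z : ℝ} (hy : |y| = 1) (hz : z ≠ 0) :
    Tendsto (fun t : ℝ => logisticCurvature (t * z) y) atTop (nhds 0) := by
  have h1 : Tendsto (fun t : ℝ => 1 / 4 - (Real.sigmoid (t * |z|) - 1 / 2) ^ 2) atTop
      (nhds (1 / 4 - (1 - 1 / 2) ^ 2)) :=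
    (((Real.tendsto_sigmoid_atTop.comp (tendsto_id.atTop_mul_const (abs_pos.2 hz))).sub_const
      (1 / 2)).pow 2).const_sub (1 / 4)
  rw [show (1 / 4 - (1 - 1 / 2) ^ 2 : ℝ) = 0 by norm_num] at h1
  refine tendsto_of_tendsto_of_tendsto_of_le_of_le' tendsto_const_nhds h1
    (Eventually.of_forall fun t => logisticCurvature_nonneg _ _) ?_
  filter_upwards [eventually_ge_atTop 0] with t ht
  refine logisticCurvature_le hy (by positivity) ?_
  rw [abs_mul, abs_of_nonneg ht]

/-! ### The retained Hessian -/

variable {n d : ℕ} {lam : ℝ} {S : Fin n → EuclideanSpace ℝ (Fin d) × ℝ}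

theorem retainedHessian_apply (lam : ℝ) (S : Fin n → EuclideanSpace ℝ (Fin d) × ℝ)
    (T : Finset (Fin n)) (θ v : EuclideanSpace ℝ (Fin d)) :
    retainedHessian lam S T θ v =
      ∑ i ∈ Tᶜ, (logisticCurvature (inner ℝ θ (S i).1) (S i).2 * inner ℝ (S i).1 v) • (S i).1 +
        ((Tᶜ.card : ℝ) * lam) • v := by
  simp [retainedHessian, hessian_sampleLoss, Finset.sum_add_distrib, mul_smul]
  rw [smul_comm, Nat.cast_smul_eq_nsmul]

theorem inner_retainedHessian (lam : ℝ) (S : Fin n → EuclideanSpace ℝ (Fin d) × ℝ)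
    (T : Finset (Fin n)) (θ v w : EuclideanSpace ℝ (Fin d)) :
    inner ℝ (retainedHessian lam S T θ v) w =
      ∑ i ∈ Tᶜ, logisticCurvature (inner ℝ θ (S i).1) (S i).2 * inner ℝ v (S i).1 *
        inner ℝ w (S i).1 + (Tᶜ.card : ℝ) * lam * inner ℝ v w := by
  rw [retainedHessian_apply, inner_add_left, sum_inner, real_inner_smul_left]
  congr 1
  refine Finset.sum_congr rfl fun i _ => ?_
  rw [real_inner_smul_left, real_inner_comm v, real_inner_comm w]

/-! ### The Lipschitz constant of the retained Hessian -/

theorem mul_mul_le_cubes {x y z : ℝ} (hx : 0 ≤ x) (hy : 0 ≤ y) (hz : 0 ≤ z) :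
    x * y * z ≤ (x ^ 3 + y ^ 3 + z ^ 3) / 3 := by
  nlinarith [mul_nonneg hx (sq_nonneg (y - z)), mul_nonneg hy (sq_nonneg (x - z)),
    mul_nonneg hz (sq_nonneg (x - y)), mul_nonneg hx (sq_nonneg (x - y)),
    mul_nonneg hx (sq_nonneg (x - z)), mul_nonneg hy (sq_nonneg (x - y)),
    mul_nonneg hy (sq_nonneg (y - z)), mul_nonneg hz (sq_nonneg (x - z)),
    mul_nonneg hz (sq_nonneg (y - z))]

/-- A uniform bound for third absolute moments bounds the trilinear form of the sample. -/
theorem sum_abs_inner_mul_le {K : ℝ}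
    (hcube : ∀ u : EuclideanSpace ℝ (Fin d), ∑ i, |inner ℝ u (S i).1| ^ 3 ≤ K * n * ‖u‖ ^ 3)
    (T : Finset (Fin n)) (h v w : EuclideanSpace ℝ (Fin d)) :
    ∑ i ∈ T, |inner ℝ h (S i).1| * |inner ℝ v (S i).1| * |inner ℝ w (S i).1| ≤
      K * n * (‖h‖ * ‖v‖ * ‖w‖) := by
  -- For unit vectors the inequality of arithmetic and geometric means reduces to the three cubes;
  -- homogeneity gives the rest.
  have unit : ∀ h v w : EuclideanSpace ℝ (Fin d), ‖h‖ = 1 → ‖v‖ = 1 → ‖w‖ = 1 →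
      ∑ i ∈ T, |inner ℝ h (S i).1| * |inner ℝ v (S i).1| * |inner ℝ w (S i).1| ≤ K * n := by
    intro h v w hh hv hw
    have h1 := hcube h
    have h2 := hcube v
    have h3 := hcube w
    rw [hh, one_pow, mul_one] at h1
    rw [hv, one_pow, mul_one] at h2
    rw [hw, one_pow, mul_one] at h3
    calc _ ≤ ∑ i, |inner ℝ h (S i).1| * |inner ℝ v (S i).1| * |inner ℝ w (S i).1| :=
          Finset.sum_le_sum_of_subset_of_nonneg (Finset.subset_univ _)
            fun i _ _ => by positivity
      _ ≤ ∑ i, (|inner ℝ h (S i).1| ^ 3 + |inner ℝ v (S i).1| ^ 3 +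
            |inner ℝ w (S i).1| ^ 3) / 3 :=
          Finset.sum_le_sum fun i _ =>
            mul_mul_le_cubes (abs_nonneg _) (abs_nonneg _) (abs_nonneg _)
      _ = (∑ i, |inner ℝ h (S i).1| ^ 3 + ∑ i, |inner ℝ v (S i).1| ^ 3 +
            ∑ i, |inner ℝ w (S i).1| ^ 3) / 3 := by
          rw [← Finset.sum_div, Finset.sum_add_distrib, Finset.sum_add_distrib]
      _ ≤ K * n := by linarith
  by_cases h0 : h = 0
  · simp [h0]
  by_cases v0 : v = 0
  · simp [v0]
  by_cases w0 : w = 0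
  · simp [w0]
  have nh := norm_pos_iff.2 h0
  have nv := norm_pos_iff.2 v0
  have nw := norm_pos_iff.2 w0
  have := unit (‖h‖⁻¹ • h) (‖v‖⁻¹ • v) (‖w‖⁻¹ • w) (by simp [norm_smul, nh.ne'])
    (by simp [norm_smul, nv.ne']) (by simp [norm_smul, nw.ne'])
  have e : ∀ i, |inner ℝ (‖h‖⁻¹ • h) (S i).1| * |inner ℝ (‖v‖⁻¹ • v) (S i).1| *
      |inner ℝ (‖w‖⁻¹ • w) (S i).1| =
      (‖h‖ * ‖v‖ * ‖w‖)⁻¹ * (|inner ℝ h (S i).1| * |inner ℝ v (S i).1| * |inner ℝ w (S i).1|) := by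
    intro i
    simp only [real_inner_smul_left, abs_mul, abs_inv, abs_norm, mul_inv]
    ring
  simp only [e, ← Finset.mul_sum] at this
  rw [inv_mul_le_iff₀ (by positivity)] at this
  linarith

/-- The regularization cancels in the difference. Testing the image `w` of `v` against itself bounds
`‖w‖ ^ 2` by the trilinear form at `θ - θ'`, `v`, `w`, and one factor `‖w‖` is divided out. -/
theorem norm_retainedHessian_sub_le {K : ℝ} (hK : 0 ≤ K) (hy : ∀ i, |(S i).2| = 1)
    (hcube : ∀ u : EuclideanSpace ℝ (Fin d), ∑ i, |inner ℝ u (S i).1| ^ 3 ≤ K * n * ‖u‖ ^ 3)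
    (T : Finset (Fin n)) (θ θ' : EuclideanSpace ℝ (Fin d)) :
    ‖retainedHessian lam S T θ - retainedHessian lam S T θ'‖ ≤ K * n * ‖θ - θ'‖ := by
  refine ContinuousLinearMap.opNorm_le_bound _ (by positivity) fun v => ?_
  set w := (retainedHessian lam S T θ - retainedHessian lam S T θ') v with hw
  have h1 : inner ℝ w w ≤ K * n * (‖θ - θ'‖ * ‖v‖ * ‖w‖) := by
    have e : inner ℝ w w = ∑ i ∈ Tᶜ,
        (logisticCurvature (inner ℝ θ (S i).1) (S i).2 -
          logisticCurvature (inner ℝ θ' (S i).1) (S i).2) * inner ℝ v (S i).1 *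
          inner ℝ w (S i).1 := by
      have e0 : inner ℝ w w =
          inner ℝ (retainedHessian lam S T θ v - retainedHessian lam S T θ' v) w := rfl
      rw [e0, inner_sub_left, inner_retainedHessian, inner_retainedHessian,
        add_sub_add_right_eq_sub, ← Finset.sum_sub_distrib]
      exact Finset.sum_congr rfl fun i _ => by ring
    rw [e]
    refine le_trans (Finset.sum_le_sum fun i _ => ?_) (sum_abs_inner_mul_le hcube Tᶜ _ _ _)
    refine (le_abs_self _).trans ?_
    rw [abs_mul, abs_mul, inner_sub_left]
    exact mul_le_mul_of_nonneg_right (mul_le_mul_of_nonneg_right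
      (abs_logisticCurvature_sub_le (hy i) _ _) (abs_nonneg _)) (abs_nonneg _)
  rw [real_inner_self_eq_norm_sq] at h1
  rcases (norm_nonneg w).eq_or_lt with h0 | h0
  · rw [← h0]; positivity
  · nlinarith

theorem cLip_le {K : ℝ} (hK : 0 ≤ K) (hy : ∀ i, |(S i).2| = 1)
    (hcube : ∀ u : EuclideanSpace ℝ (Fin d), ∑ i, |inner ℝ u (S i).1| ^ 3 ≤ K * n * ‖u‖ ^ 3)
    (T : Finset (Fin n)) : cLip lam S T ≤ K * n :=
  csInf_le ⟨0, fun _ h => h.1⟩ ⟨by positivity, norm_retainedHessian_sub_le hK hy hcube T⟩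

/-- Between `0` and the basis vector `e` the curvature of a sample falls from its maximum `1 / 4` by
at least a constant whenever its coordinate exceeds `1 / 8` in absolute value. Removing `T` destroys
at most half of these samples, and the others add up in the quadratic form in direction `e`. -/
theorem le_cLip {K δ : ℝ} (hK : 0 ≤ K) (hy : ∀ i, |(S i).2| = 1)
    (hcube : ∀ u : EuclideanSpace ℝ (Fin d), ∑ i, |inner ℝ u (S i).1| ^ 3 ≤ K * n * ‖u‖ ^ 3)
    {T : Finset (Fin n)} (j : Fin d)
    (hbig : δ * n ≤ ((Finset.univ.filter fun i => 1 / 8 ≤ |(S i).1 j|).card : ℝ))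
    (hT : (T.card : ℝ) ≤ δ / 2 * n) :
    δ / 2 * ((Real.sigmoid (1 / 8) - 1 / 2) ^ 2 / 64) * n ≤ cLip lam S T := by
  -- The upper bound is needed even here: without an admissible constant the infimum would be the
  -- default value `0`.
  refine le_csInf ⟨_, by positivity, norm_retainedHessian_sub_le hK hy hcube T⟩ ?_
  rintro C ⟨hC0, hC⟩
  set e : EuclideanSpace ℝ (Fin d) := EuclideanSpace.single j 1 with he
  have hne : ‖e‖ = 1 := by simp [he]
  have hin : ∀ i, inner ℝ e (S i).1 = (S i).1 j := fun i => by simp [he, EuclideanSpace.inner_single_left]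
  set τ := (Real.sigmoid (1 / 8) - 1 / 2) ^ 2 with hτ
  have h1 := hC 0 e
  rw [zero_sub, norm_neg, hne, mul_one] at h1
  have h2 : inner ℝ ((retainedHessian lam S T 0 - retainedHessian lam S T e) e) e ≤ C := by
    refine (real_inner_le_norm _ _).trans ?_
    rw [hne, mul_one]
    refine (ContinuousLinearMap.le_opNorm _ _).trans ?_
    rwa [hne, mul_one]
  have h3 : inner ℝ ((retainedHessian lam S T 0 - retainedHessian lam S T e) e) e =
      ∑ i ∈ Tᶜ, (1 / 4 - logisticCurvature ((S i).1 j) (S i).2) * (S i).1 j ^ 2 := by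
    rw [sub_apply, inner_sub_left, inner_retainedHessian, inner_retainedHessian,
        add_sub_add_right_eq_sub, ← Finset.sum_sub_distrib]
    refine Finset.sum_congr rfl fun i _ => ?_
    rw [hin, inner_zero_left, logisticCurvature_zero (hy i)]; ring
  rw [h3] at h2
  set F := (Finset.univ.filter fun i => 1 / 8 ≤ |(S i).1 j|) \ T with hF
  have hFc : δ / 2 * n ≤ F.card := by
    have := Finset.le_card_sdiff T (Finset.univ.filter fun i => 1 / 8 ≤ |(S i).1 j|)
    have h4 : ((Finset.univ.filter fun i => 1 / 8 ≤ |(S i).1 j|).card : ℝ) ≤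
        F.card + T.card := by
      rw [← hF] at this
      exact_mod_cast (by omega : (Finset.univ.filter fun i => 1 / 8 ≤ |(S i).1 j|).card ≤
        F.card + T.card)
    linarith
  have hsub : F ⊆ Tᶜ := fun i hi => by
    rw [Finset.mem_compl]; exact (Finset.mem_sdiff.1 hi).2
  have hτ0 : 0 ≤ τ := sq_nonneg _
  have hterm : ∀ i, 0 ≤ 1 / 4 - logisticCurvature ((S i).1 j) (S i).2 := fun i => by
    rw [logisticCurvature_eq (hy i)]; nlinarith [sq_nonneg (Real.sigmoid (-((S i).2 * (S i).1 j)) - 1 / 2)]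
  have h5 : (F.card : ℝ) * (τ / 64) ≤
      ∑ i ∈ Tᶜ, (1 / 4 - logisticCurvature ((S i).1 j) (S i).2) * (S i).1 j ^ 2 := by
    refine le_trans ?_ (Finset.sum_le_sum_of_subset_of_nonneg hsub
      fun i _ _ => mul_nonneg (hterm i) (sq_nonneg _))
    rw [← nsmul_eq_mul]
    refine Finset.card_nsmul_le_sum _ _ _ fun i hi => ?_
    have hi' : 1 / 8 ≤ |(S i).1 j| := (Finset.mem_filter.1 (Finset.mem_sdiff.1 hi).1).2
    have h6 := logisticCurvature_le (hy i) (by norm_num) hi'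
    have h7 : (1 / 64 : ℝ) ≤ (S i).1 j ^ 2 := by
      rw [← sq_abs]; nlinarith
    have h8 := mul_le_mul (by linarith : τ ≤ 1 / 4 - logisticCurvature ((S i).1 j) (S i).2) h7
      (by norm_num) (hterm i)
    linarith
  nlinarith

/-! ### The inverse of the retained Hessian -/

theorem norm_le_norm_retainedHessian (T : Finset (Fin n))
    (θ v : EuclideanSpace ℝ (Fin d)) :
    (Tᶜ.card : ℝ) * lam * ‖v‖ ≤ ‖retainedHessian lam S T θ v‖ := by
  have h1 : (Tᶜ.card : ℝ) * lam * ‖v‖ ^ 2 ≤ inner ℝ (retainedHessian lam S T θ v) v := by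
    rw [inner_retainedHessian, real_inner_self_eq_norm_sq]
    have : 0 ≤ ∑ i ∈ Tᶜ, logisticCurvature (inner ℝ θ (S i).1) (S i).2 * inner ℝ v (S i).1 *
        inner ℝ v (S i).1 := Finset.sum_nonneg fun i _ => by
      rw [mul_assoc]
      exact mul_nonneg (logisticCurvature_nonneg _ _) (mul_self_nonneg _)
    linarith
  have h2 := real_inner_le_norm (retainedHessian lam S T θ v) v
  rcases (norm_nonneg v).eq_or_lt with h0 | h0
  · rw [← h0]; simp
  · have : (Tᶜ.card : ℝ) * lam * ‖v‖ * ‖v‖ ≤ ‖retainedHessian lam S T θ v‖ * ‖v‖ := by nlinarith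
    exact le_of_mul_le_mul_right this h0

theorem retainedHessian_isInvertible (hlam : 0 < lam) {T : Finset (Fin n)} (hT : 0 < Tᶜ.card)
    (θ : EuclideanSpace ℝ (Fin d)) : (retainedHessian lam S T θ).IsInvertible := by
  have hc : 0 < (Tᶜ.card : ℝ) * lam := by positivity
  have hinj : Function.Injective (retainedHessian lam S T θ).toLinearMap := by
    rw [← LinearMap.ker_eq_bot, LinearMap.ker_eq_bot']
    intro v hv
    have := norm_le_norm_retainedHessian (lam := lam) (S := S) T θ v
    have hv' : retainedHessian lam S T θ v = 0 := hv
    rw [hv', norm_zero] at this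
    have : ‖v‖ ≤ 0 := by
      by_contra! h
      nlinarith [mul_pos hc h]
    exact norm_le_zero_iff.1 this
  refine ⟨(LinearEquiv.ofInjectiveEndo _ hinj).toContinuousLinearEquiv, ?_⟩
  ext v
  rfl

theorem norm_inverse_retainedHessian_le (hlam : 0 < lam) {T : Finset (Fin n)} (hT : 0 < Tᶜ.card)
    (θ : EuclideanSpace ℝ (Fin d)) :
    ‖(retainedHessian lam S T θ).inverse‖ ≤ 1 / (Tᶜ.card * lam) := by
  have hc : 0 < (Tᶜ.card : ℝ) * lam := by positivity
  refine ContinuousLinearMap.opNorm_le_bound _ (by positivity) fun v => ?_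
  have h := norm_le_norm_retainedHessian (lam := lam) (S := S) T θ ((retainedHessian lam S T θ).inverse v)
  have e := (retainedHessian_isInvertible (S := S) hlam hT θ).self_comp_inverse
  have e' := DFunLike.congr_fun e v
  rw [ContinuousLinearMap.comp_apply] at e'
  rw [e', ContinuousLinearMap.id_apply] at h
  rw [one_div, ← div_eq_inv_mul, le_div_iff₀ hc]
  linarith

theorem cOp_le (hlam : 0 < lam) {T : Finset (Fin n)} (hT : 0 < Tᶜ.card) :
    cOp lam S T ≤ 1 / (Tᶜ.card * lam) :=
  csInf_le ⟨0, fun _ h => h.1⟩ ⟨by positivity, fun θ =>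
    ⟨retainedHessian_isInvertible hlam hT θ, norm_inverse_retainedHessian_le hlam hT θ⟩⟩

/-- Along `t • e` every score is `t` times a nonzero coordinate, so all curvatures vanish as `t → ∞`
and the Hessian maps `e` to nearly `(|Tᶜ| lam) • e`. An admissible `C` satisfies `1 ≤ C * ‖H e‖` for
all `t`, hence in the limit. -/
theorem le_cOp (hlam : 0 < lam) (hy : ∀ i, |(S i).2| = 1) (j : Fin d)
    (hj : ∀ i, (S i).1 j ≠ 0) {T : Finset (Fin n)} (hT : 0 < Tᶜ.card) :
    1 / (Tᶜ.card * lam) ≤ cOp lam S T := by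
  have hc : 0 < (Tᶜ.card : ℝ) * lam := by positivity
  refine le_csInf ⟨1 / (Tᶜ.card * lam), by positivity, fun θ =>
    ⟨retainedHessian_isInvertible hlam hT θ, norm_inverse_retainedHessian_le hlam hT θ⟩⟩ ?_
  rintro C ⟨hC0, hC⟩
  set e : EuclideanSpace ℝ (Fin d) := EuclideanSpace.single j 1 with he
  have hne : ‖e‖ = 1 := by simp [he]
  have key : ∀ t : ℝ, 1 ≤ C * ‖retainedHessian lam S T (t • e) e‖ := by
    intro t
    obtain ⟨hi, hn⟩ := hC (t • e)
    have e' := DFunLike.congr_fun hi.inverse_comp_self e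
    rw [ContinuousLinearMap.comp_apply, ContinuousLinearMap.id_apply] at e'
    calc (1 : ℝ) = ‖(retainedHessian lam S T (t • e)).inverse
          (retainedHessian lam S T (t • e) e)‖ := by rw [e', hne]
      _ ≤ _ := (ContinuousLinearMap.le_opNorm _ _).trans
          (mul_le_mul_of_nonneg_right hn (norm_nonneg _))
  have hlim : Tendsto (fun t : ℝ => retainedHessian lam S T (t • e) e) atTop
      (nhds (((Tᶜ.card : ℝ) * lam) • e)) := by
    simp only [retainedHessian_apply]
    have h0 : Tendsto (fun t : ℝ => ∑ i ∈ Tᶜ,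
        (logisticCurvature (inner ℝ (t • e) (S i).1) (S i).2 * inner ℝ (S i).1 e) • (S i).1) atTop
        (nhds (∑ i ∈ Tᶜ, ((0 : ℝ) * inner ℝ (S i).1 e) • (S i).1)) := by
      refine tendsto_finsetSum _ fun i _ => Tendsto.smul_const (Tendsto.mul_const _ ?_) _
      have : ∀ t : ℝ, inner ℝ (t • e) (S i).1 = t * (S i).1 j := fun t => by
        rw [real_inner_smul_left]; simp [he, EuclideanSpace.inner_single_left]
      simp only [this]
      exact tendsto_logisticCurvature (hy i) (hj i)
    simpa using h0.add_const (((Tᶜ.card : ℝ) * lam) • e)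
  have h1 : 1 ≤ C * ‖((Tᶜ.card : ℝ) * lam) • e‖ :=
    ge_of_tendsto (hlim.norm.const_mul C) (Eventually.of_forall key)
  rw [norm_smul, hne, mul_one, Real.norm_eq_abs, abs_of_pos hc] at h1
  rw [div_le_iff₀ hc]
  exact h1

/-! ### The gradients at the trained model -/

theorem isMinOn_trainedModel (hlam : 0 < lam) (hn : 0 < n)
    (S : Fin n → EuclideanSpace ℝ (Fin d) × ℝ) :
    IsMinOn (trainingLoss lam S) Set.univ (trainedModel lam S) :=
  Classical.epsilon_spec (existsUnique_isMinOn_trainingLoss hlam hn S).exists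

theorem sum_gradient_trainedModel (hlam : 0 < lam) (hn : 0 < n)
    (S : Fin n → EuclideanSpace ℝ (Fin d) × ℝ) :
    ∑ i, gradient (sampleLoss lam (S i)) (trainedModel lam S) = 0 := by
  have hmin := (isMinOn_trainedModel hlam hn S).isLocalMin Filter.univ_mem
  have e : trainingLoss lam S = fun θ => ∑ i, sampleLoss lam (S i) θ :=
    funext fun θ => trainingLoss_eq_sum lam S θ
  have hd : HasFDerivAt (trainingLoss lam S) (∑ i, InnerProductSpace.toDual ℝ _
      (gradient (sampleLoss lam (S i)) (trainedModel lam S))) (trainedModel lam S) := by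
    rw [e]
    refine HasFDerivAt.fun_sum fun i _ => ?_
    rw [gradient_sampleLoss]
    exact (hasGradientAt_sampleLoss lam (S i) _).hasFDerivAt
  have := hmin.hasFDerivAt_eq_zero hd
  rw [← map_sum] at this
  exact (InnerProductSpace.toDual ℝ (EuclideanSpace ℝ (Fin d))).injective
    (this.trans (map_zero _).symm)

theorem norm_gradient_le_cGrad (i : Fin n) :
    ‖gradient (sampleLoss lam (S i)) (trainedModel lam S)‖ ≤ cGrad lam S :=
  le_ciSup (f := fun i : Fin n => ‖gradient (sampleLoss lam (S i)) (trainedModel lam S)‖)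
    (Set.finite_range _).bddAbove i

theorem cGrad_nonneg : 0 ≤ cGrad lam S := Real.iSup_nonneg fun _ => norm_nonneg _

/-- Since the gradients sum to zero, `lam` times the trained model is an average of vectors of norm
at most `R`. This controls the regularization term for every size of `lam`. -/
theorem cGrad_le (hlam : 0 < lam) (hn : 0 < n) (hy : ∀ i, |(S i).2| = 1) {R : ℝ}
    (hR : ∀ i, ‖(S i).1‖ ≤ R) : cGrad lam S ≤ 2 * R := by
  have : Nonempty (Fin n) := ⟨⟨0, hn⟩⟩
  have hp : ∀ i, ‖-((S i).2 * Real.sigmoid (-((S i).2 * inner ℝ (trainedModel lam S) (S i).1))) •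
      (S i).1‖ ≤ R := by
    intro i
    rw [norm_smul, norm_neg, Real.norm_eq_abs]
    exact (mul_le_of_le_one_left (norm_nonneg _) (abs_mul_sigmoid_le (hy i) _)).trans (hR i)
  have h0 := sum_gradient_trainedModel hlam hn S
  simp only [gradient_sampleLoss, Finset.sum_add_distrib, Finset.sum_const, Finset.card_univ,
    Fintype.card_fin] at h0
  have h1 : n * ‖lam • trainedModel lam S‖ ≤ n * R := by
    have h2 := eq_neg_of_add_eq_zero_right h0
    have h3 := congrArg norm h2
    rw [norm_neg, ← Nat.cast_smul_eq_nsmul ℝ, norm_smul, Real.norm_natCast] at h3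
    rw [h3]
    refine (norm_sum_le_of_le _ fun i _ => hp i).trans ?_
    simp
  have h2 : ‖lam • trainedModel lam S‖ ≤ R := le_of_mul_le_mul_left h1 (by exact_mod_cast hn)
  refine ciSup_le fun i => ?_
  rw [gradient_sampleLoss]
  linarith [norm_add_le (-((S i).2 * Real.sigmoid (-((S i).2 * inner ℝ (trainedModel lam S)
    (S i).1))) • (S i).1) (lam • trainedModel lam S), hp i]

/-! ### Lower bound for the gradients of the samples -/

theorem card_filter_lt_mul_le {K M : ℝ} (hM : 0 ≤ M)
    (hcube : ∀ u : EuclideanSpace ℝ (Fin d), ∑ i, |inner ℝ u (S i).1| ^ 3 ≤ K * n * ‖u‖ ^ 3)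
    (θ : EuclideanSpace ℝ (Fin d)) :
    ((Finset.univ.filter fun i => M < |inner ℝ θ (S i).1|).card : ℝ) * M ^ 3 ≤
      K * n * ‖θ‖ ^ 3 := by
  refine le_trans ?_ (hcube θ)
  refine le_trans ?_ (Finset.sum_le_sum_of_subset_of_nonneg
    (Finset.filter_subset (fun i => M < |inner ℝ θ (S i).1|) Finset.univ)
    fun i _ _ => by positivity)
  rw [← nsmul_eq_mul]
  refine Finset.card_nsmul_le_sum _ _ _ fun i hi => ?_
  exact pow_le_pow_left₀ hM (Finset.mem_filter.1 hi).2.le 3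

/-- The shift `w`, which will be a coordinate of `lam θ̂`, is common to all samples and cannot
cancel both small and large entries. If it is large, the samples with tiny coordinate `j` keep it;
if it is small, the samples with large coordinate `j` and bounded score dominate it. -/
theorem le_sum_sq_coordinate {K B M δ δ' : ℝ} (hK : 0 ≤ K) (hM : 0 < M) (hδ' : 0 < δ') (hδ : δ' ≤ δ)
    (hMB : 2 * K * B ^ 3 ≤ δ * M ^ 3) (hy : ∀ i, |(S i).2| = 1)
    (hcube : ∀ u : EuclideanSpace ℝ (Fin d), ∑ i, |inner ℝ u (S i).1| ^ 3 ≤ K * n * ‖u‖ ^ 3)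
    (j : Fin d)
    (hbig : δ * n ≤ ((Finset.univ.filter fun i => 1 / 8 ≤ |(S i).1 j|).card : ℝ))
    (hsmall : δ' * n ≤
      ((Finset.univ.filter fun i => |(S i).1 j| ≤ Real.sigmoid (-M) / 32).card : ℝ))
    {θ : EuclideanSpace ℝ (Fin d)} (hθ : ‖θ‖ ≤ B) (w : ℝ) :
    δ' / 2 * (Real.sigmoid (-M) / 32) ^ 2 * n ≤
      ∑ i, (-((S i).2 * Real.sigmoid (-((S i).2 * inner ℝ θ (S i).1))) * (S i).1 j + w) ^ 2 := by
  -- With bounded score and coordinate at least `1 / 8` the entry is at least `32 η / 8 = 4 η`. The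
  -- threshold `2 η` for the shift then leaves at least `η` in either case.
  set η := Real.sigmoid (-M) / 32 with hη
  have hη0 : 0 < η := div_pos (Real.sigmoid_pos _) (by norm_num)
  have main : ∀ F : Finset (Fin n), δ' / 2 * n ≤ F.card →
      (∀ i ∈ F, η ≤ |-((S i).2 * Real.sigmoid (-((S i).2 * inner ℝ θ (S i).1))) * (S i).1 j + w|) →
      δ' / 2 * η ^ 2 * n ≤
      ∑ i, (-((S i).2 * Real.sigmoid (-((S i).2 * inner ℝ θ (S i).1))) * (S i).1 j + w) ^ 2 := by
    intro F hF h
    refine le_trans ?_ (Finset.sum_le_sum_of_subset_of_nonneg (Finset.subset_univ F)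
      fun i _ _ => sq_nonneg _)
    refine le_trans ?_ (Finset.card_nsmul_le_sum F _ (η ^ 2) fun i hi => ?_)
    · rw [nsmul_eq_mul]; nlinarith [sq_nonneg η]
    · rw [← sq_abs (_ + w)]
      exact pow_le_pow_left₀ hη0.le (h i hi) 2
  have hn0 : (0 : ℝ) ≤ n := n.cast_nonneg
  rcases le_or_gt (2 * η) |w| with hw | hw
  · refine main _ (le_trans (by nlinarith) hsmall) fun i hi => ?_
    have hi' := (Finset.mem_filter.1 hi).2
    have h1 : |-((S i).2 * Real.sigmoid (-((S i).2 * inner ℝ θ (S i).1))) * (S i).1 j| ≤ η := by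
      rw [abs_mul, abs_neg]
      exact (mul_le_of_le_one_left (abs_nonneg _) (abs_mul_sigmoid_le (hy i) _)).trans hi'
    have h2 := abs_sub_abs_le_abs_sub w
      (-(-((S i).2 * Real.sigmoid (-((S i).2 * inner ℝ θ (S i).1))) * (S i).1 j))
    rw [abs_neg, sub_neg_eq_add, add_comm w] at h2
    linarith
  · have hexc := card_filter_lt_mul_le hM.le hcube θ
    set A := Finset.univ.filter fun i => 1 / 8 ≤ |(S i).1 j|
    set X := Finset.univ.filter fun i => M < |inner ℝ θ (S i).1|
    -- Markov's inequality for third moments; `M` is chosen so that large scores spoil at most half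
    -- of the samples in `A`.
    have hX : (X.card : ℝ) ≤ δ / 2 * n := by
      have hM3 : 0 < M ^ 3 := by positivity
      have h3 : ‖θ‖ ^ 3 ≤ B ^ 3 := pow_le_pow_left₀ (norm_nonneg _) hθ 3
      have h4 : K * n * ‖θ‖ ^ 3 ≤ K * n * B ^ 3 := by gcongr
      have h5 : K * n * B ^ 3 ≤ δ / 2 * n * M ^ 3 := by nlinarith
      exact le_of_mul_le_mul_right (hexc.trans (h4.trans h5)) hM3
    refine main (A \ X) ?_ fun i hi => ?_
    · have := Finset.le_card_sdiff X A
      have h4 : (A.card : ℝ) ≤ (A \ X).card + X.card := by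
        exact_mod_cast (by omega : A.card ≤ (A \ X).card + X.card)
      linarith [mul_le_mul_of_nonneg_right hδ hn0]
    · have hiA : 1 / 8 ≤ |(S i).1 j| := (Finset.mem_filter.1 (Finset.mem_sdiff.1 hi).1).2
      have hiX : |inner ℝ θ (S i).1| ≤ M := by
        by_contra! h
        exact (Finset.mem_sdiff.1 hi).2 (Finset.mem_filter.2 ⟨Finset.mem_univ _, h⟩)
      have hp : 32 * η ≤ Real.sigmoid (-((S i).2 * inner ℝ θ (S i).1)) := by
        rw [hη, mul_div_cancel₀ _ (by norm_num)]
        refine Real.sigmoid_le (neg_le_neg ?_)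
        refine (le_abs_self _).trans ?_
        rwa [abs_mul, hy i, one_mul]
      have h1 : 4 * η ≤
          |-((S i).2 * Real.sigmoid (-((S i).2 * inner ℝ θ (S i).1))) * (S i).1 j| := by
        rw [abs_mul, abs_neg, abs_mul, hy i, one_mul, abs_of_pos (Real.sigmoid_pos _)]
        have := mul_le_mul hp hiA (by norm_num) (Real.sigmoid_nonneg _)
        linarith
      have h2 := abs_sub_abs_le_abs_sub
        (-((S i).2 * Real.sigmoid (-((S i).2 * inner ℝ θ (S i).1))) * (S i).1 j) (-w)
      rw [abs_neg w, sub_neg_eq_add] at h2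
      linarith

/-- The maximum dominates the mean square, to which each of the `d` coordinates adds a constant. -/
theorem le_cGrad {K B M δ δ' : ℝ} (hn : 0 < n) (hK : 0 ≤ K) (hM : 0 < M) (hδ' : 0 < δ') (hδ : δ' ≤ δ)
    (hMB : 2 * K * B ^ 3 ≤ δ * M ^ 3) (hy : ∀ i, |(S i).2| = 1)
    (hcube : ∀ u : EuclideanSpace ℝ (Fin d), ∑ i, |inner ℝ u (S i).1| ^ 3 ≤ K * n * ‖u‖ ^ 3)
    (hbig : ∀ j, δ * n ≤ ((Finset.univ.filter fun i => 1 / 8 ≤ |(S i).1 j|).card : ℝ))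
    (hsmall : ∀ j, δ' * n ≤
      ((Finset.univ.filter fun i => |(S i).1 j| ≤ Real.sigmoid (-M) / 32).card : ℝ))
    (hθ : ‖trainedModel lam S‖ ≤ B) :
    √(δ' / 2 * (Real.sigmoid (-M) / 32) ^ 2) * √d ≤ cGrad lam S := by
  set c := δ' / 2 * (Real.sigmoid (-M) / 32) ^ 2 with hc
  have h1 : ∑ i, ‖gradient (sampleLoss lam (S i)) (trainedModel lam S)‖ ^ 2 ≤
      n * cGrad lam S ^ 2 := by
    refine (Finset.sum_le_card_nsmul _ _ (cGrad lam S ^ 2) fun i _ =>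
      pow_le_pow_left₀ (norm_nonneg _) (norm_gradient_le_cGrad i) 2).trans ?_
    simp
  have h2 : (d : ℝ) * (c * n) ≤
      ∑ i, ‖gradient (sampleLoss lam (S i)) (trainedModel lam S)‖ ^ 2 := by
    have e : ∀ i, ‖gradient (sampleLoss lam (S i)) (trainedModel lam S)‖ ^ 2 =
        ∑ j, (-((S i).2 * Real.sigmoid (-((S i).2 * inner ℝ (trainedModel lam S) (S i).1))) *
          (S i).1 j + lam * trainedModel lam S j) ^ 2 := by
      intro i
      rw [gradient_sampleLoss, EuclideanSpace.real_norm_sq_eq]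
      simp
    simp only [e]
    rw [Finset.sum_comm]
    have := Finset.card_nsmul_le_sum (Finset.univ : Finset (Fin d)) _ (c * n) fun j _ =>
      le_sum_sq_coordinate hK hM hδ' hδ hMB hy hcube j (hbig j) (hsmall j) hθ
        (lam * trainedModel lam S j)
    simpa using this
  rw [← Real.sqrt_mul (by positivity)]
  refine Real.sqrt_le_iff.2 ⟨cGrad_nonneg, ?_⟩
  have hn' : (0 : ℝ) < n := by exact_mod_cast hn
  have : (n : ℝ) * (c * d) ≤ n * cGrad lam S ^ 2 := by linarith
  exact le_of_mul_le_mul_left this hn'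

end Deterministic

section Moments

/-! ### Gaussian moments -/

/-- The moment `𝔼 exp (3 g² / 8)` of a standard Gaussian `g`. -/
def gaussianExpMoment : ℝ := ∫ x, Real.exp (3 / 8 * x ^ 2) ∂(gaussianReal 0 1)

theorem one_le_gaussianExpMoment : 1 ≤ gaussianExpMoment := by
  have := integral_mono (μ := gaussianReal 0 1) (integrable_const (1 : ℝ))
    integrable_exp_sq_gaussianReal fun x => Real.one_le_exp (by positivity)
  rwa [integral_const, probReal_univ, one_smul] at this

theorem gaussianReal_lt_abs_le {L : ℝ} (hL : 0 ≤ L) :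
    (gaussianReal 0 1).real {x | L < |x|} ≤
      gaussianExpMoment * Real.exp (-(3 / 8 * L ^ 2)) := by
  have h := mul_meas_ge_le_integral_of_nonneg (μ := gaussianReal 0 1)
    (f := fun x : ℝ => Real.exp (3 / 8 * x ^ 2)) (ae_of_all _ fun x => (Real.exp_pos _).le)
    integrable_exp_sq_gaussianReal (Real.exp (3 / 8 * L ^ 2))
  have hsub : {x : ℝ | L < |x|} ⊆ {x | Real.exp (3 / 8 * L ^ 2) ≤ Real.exp (3 / 8 * x ^ 2)} := by
    intro x hx
    have : L ^ 2 ≤ x ^ 2 := by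
      rw [← sq_abs x]; exact pow_le_pow_left₀ hL (le_of_lt hx) 2
    exact Real.exp_le_exp.2 (by linarith)
  have h2 := measureReal_mono (μ := gaussianReal 0 1) hsub
  rw [Real.exp_neg, ← div_eq_mul_inv, le_div_iff₀ (Real.exp_pos _), mul_comm]
  exact (mul_le_mul_of_nonneg_left h2 (Real.exp_pos _).le).trans h

theorem abs_pow_three_le (t : ℝ) : |t| ^ 3 ≤ 64 * Real.exp (1 / 8 * t ^ 2) := by
  have h := Real.quadratic_le_exp_of_nonneg (x := 1 / 8 * t ^ 2) (by positivity)
  rw [← sq_abs t] at *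
  have h0 := abs_nonneg t
  nlinarith [mul_nonneg (sq_nonneg |t|) (sq_nonneg (|t| - 1)), sq_nonneg (|t| ^ 2)]

theorem abs_add_sq_mul_exp_le {m : ℝ} (hm : 1 ≤ m) (t : ℝ) :
    (|t| + m) ^ 2 * Real.exp (|t| + m) ≤
      16 * m ^ 2 * Real.exp (m + 1) * Real.exp (3 / 8 * t ^ 2) := by
  have h0 := abs_nonneg t
  have h1 : (|t| + m) ^ 2 ≤ 16 * m ^ 2 * Real.exp (1 / 8 * t ^ 2) := by
    have h := Real.add_one_le_exp (1 / 8 * t ^ 2)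
    have h2 : (|t| + m) ^ 2 ≤ m ^ 2 * (|t| + 1) ^ 2 := by
      rw [← mul_pow]
      exact pow_le_pow_left₀ (by positivity) (by nlinarith) 2
    have h3 : (|t| + 1) ^ 2 ≤ 16 * Real.exp (1 / 8 * t ^ 2) := by
      rw [← sq_abs t] at *
      nlinarith [sq_nonneg (|t| - 1)]
    nlinarith [sq_nonneg m]
  have h2 : Real.exp (|t| + m) ≤ Real.exp (m + 1) * Real.exp (1 / 4 * t ^ 2) := by
    rw [← Real.exp_add, Real.exp_le_exp, ← sq_abs t]
    nlinarith [sq_nonneg (|t| - 2)]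
  calc _ ≤ (16 * m ^ 2 * Real.exp (1 / 8 * t ^ 2)) *
        (Real.exp (m + 1) * Real.exp (1 / 4 * t ^ 2)) :=
        mul_le_mul h1 h2 (Real.exp_pos _).le (by positivity)
    _ = 16 * m ^ 2 * Real.exp (m + 1) * (Real.exp (1 / 8 * t ^ 2) * Real.exp (1 / 4 * t ^ 2)) := by
        ring
    _ = _ := by rw [← Real.exp_add]; congr 2; ring

theorem abs_le_exp_sq (t : ℝ) : |t| ≤ Real.exp (3 / 8 * t ^ 2) := by
  have h := Real.add_one_le_exp (3 / 8 * t ^ 2)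
  rw [← sq_abs t] at *
  nlinarith [sq_nonneg (|t| - 4 / 3)]

variable {a b lam : ℝ} {d : ℕ} {P : Measure (EuclideanSpace ℝ (Fin d) × ℝ)}

theorem GaussianModel.integrable_comp_inner (h : GaussianModel a b d lam P)
    {u : EuclideanSpace ℝ (Fin d)} (hu : ‖u‖ = 1) {φ : ℝ → ℝ}
    (hφ : Integrable φ (gaussianReal 0 1)) :
    Integrable (fun s => φ (inner ℝ u s.1)) P := by
  rw [← h.map_inner hu] at hφ
  exact hφ.comp_measurable (by fun_prop)

theorem GaussianModel.integral_comp_inner (h : GaussianModel a b d lam P)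
    {u : EuclideanSpace ℝ (Fin d)} (hu : ‖u‖ = 1) {φ : ℝ → ℝ}
    (hφ : AEStronglyMeasurable φ (gaussianReal 0 1)) :
    ∫ s, φ (inner ℝ u s.1) ∂P = ∫ x, φ x ∂(gaussianReal 0 1) := by
  rw [← h.map_inner hu] at hφ ⊢
  rw [integral_map (by fun_prop) hφ]

theorem GaussianModel.measureReal_inner_mem (h : GaussianModel a b d lam P)
    {u : EuclideanSpace ℝ (Fin d)} (hu : ‖u‖ = 1) {A : Set ℝ} (hA : MeasurableSet A) :
    P.real {s | inner ℝ u s.1 ∈ A} = (gaussianReal 0 1).real A := by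
  rw [← h.map_inner hu, map_measureReal_apply (by fun_prop) hA]
  rfl

theorem GaussianModel.integrable_exp_sq_inner (h : GaussianModel a b d lam P)
    {u : EuclideanSpace ℝ (Fin d)} (hu : ‖u‖ = 1) :
    Integrable (fun s => Real.exp (3 / 8 * (inner ℝ u s.1) ^ 2)) P :=
  h.integrable_comp_inner hu integrable_exp_sq_gaussianReal

theorem GaussianModel.integral_exp_sq_inner (h : GaussianModel a b d lam P)
    {u : EuclideanSpace ℝ (Fin d)} (hu : ‖u‖ = 1) :
    ∫ s, Real.exp (3 / 8 * (inner ℝ u s.1) ^ 2) ∂P = gaussianExpMoment :=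
  h.integral_comp_inner hu (φ := fun x => Real.exp (3 / 8 * x ^ 2))
    integrable_exp_sq_gaussianReal.aestronglyMeasurable

theorem GaussianModel.integrable_inner (h : GaussianModel a b d lam P)
    (u : EuclideanSpace ℝ (Fin d)) : Integrable (fun s => inner ℝ u s.1) P := by
  rcases eq_or_ne u 0 with rfl | hu
  · simp
  · have hn := norm_pos_iff.2 hu
    have h1 : ‖‖u‖⁻¹ • u‖ = 1 := by simp [norm_smul, hn.ne']
    have h2 : Integrable (fun s => inner ℝ (‖u‖⁻¹ • u) s.1) P :=
      (h.integrable_exp_sq_inner h1).mono' (by fun_prop)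
        (ae_of_all _ fun s => abs_le_exp_sq _)
    refine (h2.const_mul ‖u‖).congr (ae_of_all _ fun s => ?_)
    simp [real_inner_smul_left, mul_inv_cancel_left₀ hn.ne']

theorem GaussianModel.integral_abs_inner_le (h : GaussianModel a b d lam P)
    {u : EuclideanSpace ℝ (Fin d)} (hu : ‖u‖ = 1) :
    ∫ s, |inner ℝ u s.1| ∂P ≤ gaussianExpMoment := by
  rw [← h.integral_exp_sq_inner hu]
  exact integral_mono (h.integrable_inner u).abs (h.integrable_exp_sq_inner hu)
    fun s => abs_le_exp_sq _

/-! ### Norms of the features -/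

theorem norm_le_mul_sqrt_of_abs_le {x : EuclideanSpace ℝ (Fin d)} {L : ℝ} (hL : 0 ≤ L)
    (h : ∀ j, |x j| ≤ L) : ‖x‖ ≤ L * √d := by
  rw [EuclideanSpace.norm_eq, ← Real.sqrt_sq hL, ← Real.sqrt_mul (sq_nonneg L)]
  refine Real.sqrt_le_sqrt ?_
  refine (Finset.sum_le_card_nsmul _ _ (L ^ 2) fun j _ => ?_).trans ?_
  · exact pow_le_pow_left₀ (norm_nonneg _) (h j) 2
  · simp [mul_comm]

/-- Some coordinate must exceed `L`. This crude union bound suffices: for `L = log n` it decays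
superpolynomially, and `C_ℓ` may lose a logarithm. -/
theorem GaussianModel.measureReal_lt_norm_le (h : GaussianModel a b d lam P) {L : ℝ}
    (hL : 0 ≤ L) :
    P.real {s | L * √d < ‖s.1‖} ≤ d * (gaussianExpMoment * Real.exp (-(3 / 8 * L ^ 2))) := by
  have := h.isProbabilityMeasure
  have hsub : {s : EuclideanSpace ℝ (Fin d) × ℝ | L * √d < ‖s.1‖} ⊆
      ⋃ j ∈ (Finset.univ : Finset (Fin d)),
        {s | inner ℝ (EuclideanSpace.single j (1 : ℝ)) s.1 ∈ {x : ℝ | L < |x|}} := by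
    intro s hs
    by_contra hcon
    simp only [Finset.mem_univ, Set.iUnion_true, Set.mem_iUnion, not_exists, Set.mem_ofPred_eq,
      not_lt, EuclideanSpace.inner_single_left, map_one, one_mul] at hcon
    exact absurd hs (not_lt.2 (norm_le_mul_sqrt_of_abs_le hL hcon))
  refine (measureReal_mono hsub (measure_ne_top _ _)).trans
    ((measureReal_biUnion_finset_le _ _).trans ?_)
  refine (Finset.sum_le_card_nsmul _ _ (gaussianExpMoment * Real.exp (-(3 / 8 * L ^ 2)))
    fun j _ => ?_).trans (le_of_eq ?_)
  · rw [h.measureReal_inner_mem (by simp) (measurableSet_lt measurable_const (by fun_prop))]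
    exact gaussianReal_lt_abs_le hL
  · simp

/-! ### Third moments -/

/-- The cube of a Gaussian has no exponential moment. Truncating one factor at `√n / 4` and dividing
by `√n` makes the variable at most a quarter of the square, so its exponential is integrable, with
mean `1 + O(1 / √n)`. Chernoff then yields the rate `√n`, enough against a net of size `exp (O(d))`.
-/
theorem GaussianModel.measureReal_pi_sum_truncated_cube (h : GaussianModel a b d lam P)
    {u : EuclideanSpace ℝ (Fin d)} (hu : ‖u‖ = 1) {n : ℕ} (hn : 0 < n) :
    (Measure.pi fun _ : Fin n => P).real
      {S | 2 * (64 * gaussianExpMoment) * √n ≤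
        ∑ i, min |inner ℝ u (S i).1| (√n / 4) * (inner ℝ u (S i).1) ^ 2 / √n} ≤
      Real.exp (-(64 * gaussianExpMoment * √n)) := by
  have := h.isProbabilityMeasure
  have hq : 0 < √(n : ℝ) := Real.sqrt_pos.2 (by exact_mod_cast hn)
  have hqq : √(n : ℝ) * √n = n := Real.mul_self_sqrt n.cast_nonneg
  set q := √(n : ℝ)
  have hm := one_le_gaussianExpMoment
  set f : EuclideanSpace ℝ (Fin d) × ℝ → ℝ := fun s =>
    min |inner ℝ u s.1| (q / 4) * (inner ℝ u s.1) ^ 2 / q with hf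
  have hf0 : ∀ s, 0 ≤ f s := fun s => by
    have : 0 ≤ min |inner ℝ u s.1| (q / 4) := le_min (abs_nonneg _) (by positivity)
    positivity
  have hf1 : ∀ s, f s ≤ 1 / 4 * (inner ℝ u s.1) ^ 2 := fun s => by
    rw [hf]
    simp only
    rw [div_le_iff₀ hq]
    have := mul_le_mul_of_nonneg_right (min_le_right |inner ℝ u s.1| (q / 4))
      (sq_nonneg (inner ℝ u s.1))
    linarith
  have hf2 : ∀ s, f s ≤ |inner ℝ u s.1| ^ 3 / q := fun s => by
    have := mul_le_mul_of_nonneg_right (min_le_left |inner ℝ u s.1| (q / 4))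
      (sq_nonneg (inner ℝ u s.1))
    refine div_le_div_of_nonneg_right (this.trans (le_of_eq ?_)) hq.le
    rw [← sq_abs]; ring
  have hfc : Continuous f := by
    simp only [hf]
    fun_prop
  have hG := h.integrable_exp_sq_inner hu
  -- From `exp f - 1 ≤ f * exp f`: the factor `f` is estimated by the cube over `q`, the exponential
  -- by the quarter square.
  have hexp : ∀ s, Real.exp (f s) ≤
      1 + 64 / q * Real.exp (3 / 8 * (inner ℝ u s.1) ^ 2) := by
    intro s
    have h1 := Real.one_sub_le_exp_neg (f s)
    have h3 : Real.exp (f s) * Real.exp (-f s) = 1 := by rw [← Real.exp_add]; simp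
    have h4 : Real.exp (f s) - 1 ≤ f s * Real.exp (f s) := by nlinarith [Real.exp_pos (f s)]
    have h5 : f s * Real.exp (f s) ≤
        (64 * Real.exp (1 / 8 * (inner ℝ u s.1) ^ 2) / q) *
          Real.exp (1 / 4 * (inner ℝ u s.1) ^ 2) :=
      mul_le_mul ((hf2 s).trans (div_le_div_of_nonneg_right (abs_pow_three_le _) hq.le))
        (Real.exp_le_exp.2 (hf1 s)) (Real.exp_pos _).le (by positivity)
    have h6 : (64 * Real.exp (1 / 8 * (inner ℝ u s.1) ^ 2) / q) *
          Real.exp (1 / 4 * (inner ℝ u s.1) ^ 2) =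
        64 / q * Real.exp (3 / 8 * (inner ℝ u s.1) ^ 2) := by
      rw [show (3 / 8 : ℝ) * (inner ℝ u s.1) ^ 2 =
        1 / 8 * (inner ℝ u s.1) ^ 2 + 1 / 4 * (inner ℝ u s.1) ^ 2 by ring, Real.exp_add]
      ring
    linarith
  have hint2 : Integrable (fun s : EuclideanSpace ℝ (Fin d) × ℝ =>
      1 + 64 / q * Real.exp (3 / 8 * (inner ℝ u s.1) ^ 2)) P :=
    (integrable_const 1).add (hG.const_mul (64 / q))
  have hint : Integrable (fun s => Real.exp (f s)) P :=
    hint2.mono' (by fun_prop) (ae_of_all _ fun s => by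
      rw [Real.norm_eq_abs, Real.abs_exp]; exact hexp s)
  have hle : ∫ s, Real.exp (f s) ∂P ≤ Real.exp (64 * gaussianExpMoment / q) := by
    calc _ ≤ ∫ s, (1 + 64 / q * Real.exp (3 / 8 * (inner ℝ u s.1) ^ 2)) ∂P :=
          integral_mono hint hint2 hexp
      _ = 1 + 64 / q * gaussianExpMoment := by
          rw [integral_add (integrable_const 1) (hG.const_mul (64 / q)), integral_const_mul,
            h.integral_exp_sq_inner hu]
          simp
      _ ≤ _ := by
          have := Real.add_one_le_exp (64 * gaussianExpMoment / q)
          have e : 64 / q * gaussianExpMoment = 64 * gaussianExpMoment / q := by ring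
          linarith
  refine (measureReal_pi_sum_ge_le P n hint hle).trans (Real.exp_le_exp.2 (le_of_eq ?_))
  have : (n : ℝ) * (64 * gaussianExpMoment / q) = 64 * gaussianExpMoment * q := by
    rw [← hqq]; field_simp
  rw [this]; ring

/-- At a maximizer `w` on the sphere with net point `v`, convexity of the cube gives `F w ≤ 4 (F v +
F (w - v)) ≤ 4 A + F w / 2`, as `F` is homogeneous of degree `3` and `‖w - v‖ ≤ 1 / 2`. -/
theorem sum_abs_inner_pow_three_le_of_net {n : ℕ} {S : Fin n → EuclideanSpace ℝ (Fin d) × ℝ}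
    {N : Finset (EuclideanSpace ℝ (Fin d))} {A : ℝ}
    (hN : ∀ u : EuclideanSpace ℝ (Fin d), ‖u‖ = 1 → ∃ v ∈ N, ‖u - v‖ ≤ 1 / 2)
    (hA : ∀ v ∈ N, ∑ i, |inner ℝ v (S i).1| ^ 3 ≤ A) (u : EuclideanSpace ℝ (Fin d)) :
    ∑ i, |inner ℝ u (S i).1| ^ 3 ≤ 8 * A * ‖u‖ ^ 3 := by
  rcases eq_or_ne u 0 with rfl | hu
  · simp
  set F : EuclideanSpace ℝ (Fin d) → ℝ := fun u => ∑ i, |inner ℝ u (S i).1| ^ 3 with hF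
  have hFs : ∀ (t : ℝ) (v : EuclideanSpace ℝ (Fin d)), 0 ≤ t → F (t • v) = t ^ 3 * F v := by
    intro t v ht
    simp only [hF, Finset.mul_sum]
    refine Finset.sum_congr rfl fun i _ => ?_
    rw [real_inner_smul_left, abs_mul, mul_pow, abs_of_nonneg ht]
  have hn := norm_pos_iff.2 hu
  have hu1 : ‖‖u‖⁻¹ • u‖ = 1 := by simp [norm_smul, hn.ne']
  obtain ⟨w, hw, hmax⟩ := (isCompact_sphere (0 : EuclideanSpace ℝ (Fin d)) 1).exists_isMaxOn
    ⟨‖u‖⁻¹ • u, by simpa using hu1⟩ (f := F) (by fun_prop : Continuous F).continuousOn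
  have hw1 : ‖w‖ = 1 := by simpa using hw
  have hall : ∀ v : EuclideanSpace ℝ (Fin d), F v ≤ ‖v‖ ^ 3 * F w := by
    intro v
    rcases eq_or_ne v 0 with rfl | hv
    · simp [hF]
    · have hnv := norm_pos_iff.2 hv
      have h1 : F (‖v‖⁻¹ • v) ≤ F w := hmax (by simp [norm_smul, hnv.ne'])
      have h2 : F v = ‖v‖ ^ 3 * F (‖v‖⁻¹ • v) := by
        rw [← hFs _ _ hnv.le, smul_inv_smul₀ hnv.ne']
      rw [h2]
      exact mul_le_mul_of_nonneg_left h1 (by positivity)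
  have hFw0 : 0 ≤ F w := Finset.sum_nonneg fun i _ => by positivity
  obtain ⟨v, hvN, hv⟩ := hN w hw1
  have h3 : F w ≤ 4 * (F v + F (w - v)) := by
    simp only [hF, Finset.mul_sum, ← Finset.sum_add_distrib]
    refine Finset.sum_le_sum fun i _ => ?_
    have e : inner ℝ w (S i).1 = inner ℝ v (S i).1 + inner ℝ (w - v) (S i).1 := by
      rw [← inner_add_left]; simp
    rw [e]
    refine (pow_le_pow_left₀ (abs_nonneg _) (abs_add_le _ _) 3).trans ?_
    have := add_pow_le (abs_nonneg (inner ℝ v (S i).1)) (abs_nonneg (inner ℝ (w - v) (S i).1)) 3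
    norm_num at this
    exact this
  have h4 : ‖w - v‖ ^ 3 * F w ≤ (1 / 2) ^ 3 * F w :=
    mul_le_mul_of_nonneg_right (pow_le_pow_left₀ (norm_nonneg _) hv 3) hFw0
  have h5 := hall (w - v)
  have h6 : F w ≤ 8 * A := by linarith [hA v hvN]
  refine (hall u).trans ?_
  rw [mul_comm]
  exact mul_le_mul_of_nonneg_right h6 (by positivity)

/-! ### Counting coordinates -/

theorem GaussianModel.measureReal_pi_card_le (h : GaussianModel a b d lam P) (j : Fin d)
    {A : Set ℝ} [DecidablePred (· ∈ A)] (hA : MeasurableSet A) (n : ℕ) {μ : ℝ}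
    (hμ : μ ≤ (gaussianReal 0 1).real A) :
    (Measure.pi fun _ : Fin n => P).real
      {S | ((Finset.univ.filter fun i => (S i).1 j ∈ A).card : ℝ) ≤ n * (μ / 4)} ≤
      Real.exp (-(n * (μ / 4))) := by
  have := h.isProbabilityMeasure
  have hmeas : MeasurableSet {s : EuclideanSpace ℝ (Fin d) × ℝ |
      inner ℝ (EuclideanSpace.single j (1 : ℝ)) s.1 ∈ A} :=
    (by fun_prop : Measurable fun s : EuclideanSpace ℝ (Fin d) × ℝ =>
      inner ℝ (EuclideanSpace.single j (1 : ℝ)) s.1) hA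
  have key := measureReal_pi_sum_le_le P n (μ := μ)
    (W := Set.indicator {s | inner ℝ (EuclideanSpace.single j (1 : ℝ)) s.1 ∈ A} 1)
    (aestronglyMeasurable_one.indicator hmeas)
    (fun s => Set.indicator_nonneg (fun _ _ => zero_le_one) s)
    (fun s => Set.indicator_le_self' (fun _ _ => zero_le_one) s) (by
      rw [integral_indicator_one hmeas, h.measureReal_inner_mem (by simp) hA]; exact hμ)
  have e : ∀ S : Fin n → EuclideanSpace ℝ (Fin d) × ℝ,
      ((Finset.univ.filter fun i => (S i).1 j ∈ A).card : ℝ) =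
      ∑ i, Set.indicator {s : EuclideanSpace ℝ (Fin d) × ℝ |
        inner ℝ (EuclideanSpace.single j (1 : ℝ)) s.1 ∈ A} (1 : EuclideanSpace ℝ (Fin d) × ℝ → ℝ) (S i) := by
    intro S
    rw [Finset.card_filter, Nat.cast_sum]
    refine Finset.sum_congr rfl fun i _ => ?_
    simp [Set.indicator_apply, EuclideanSpace.inner_single_left]
  simpa only [e] using key

theorem GaussianModel.ae_coordinate_ne_zero (h : GaussianModel a b d lam P) (j : Fin d) :
    ∀ᵐ s ∂P, s.1 j ≠ 0 := by
  have := h.isProbabilityMeasure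
  have := nullSingletonClass_gaussianReal (μ := 0) (v := 1) one_ne_zero
  have h1 := h.measureReal_inner_mem (u := EuclideanSpace.single j (1 : ℝ)) (by simp)
    (MeasurableSet.singleton (0 : ℝ))
  have h2 : (gaussianReal 0 1).real {(0 : ℝ)} = 0 := by simp [measureReal_def]
  rw [h2, measureReal_eq_zero_iff] at h1
  rw [ae_iff]
  simpa [EuclideanSpace.inner_single_left] using h1

end Moments

section Growth

variable {a b lam : ℝ} {d : ℕ} {P : Measure (EuclideanSpace ℝ (Fin d) × ℝ)}

theorem GaussianModel.ae_abs_label (h : GaussianModel a b d lam P) : ∀ᵐ s ∂P, |s.2| = 1 := by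
  filter_upwards [h.labels] with s hs
  rcases hs with hs | hs <;> simp [hs]

theorem integral_sub_add {α : Type*} [MeasurableSpace α] {μ : Measure α} {f g k : α → ℝ}
    (hf : Integrable f μ) (hg : Integrable g μ) (hk : Integrable k μ) :
    ∫ s, (f s - g s + k s) ∂μ = ∫ s, f s ∂μ - ∫ s, g s ∂μ + ∫ s, k s ∂μ := by
  rw [← integral_sub hf hg]
  exact integral_add (hf.sub hg) hk

/-! ### Stationarity of the population optimum -/

theorem GaussianModel.integrable_logisticLoss (h : GaussianModel a b d lam P)
    (θ : EuclideanSpace ℝ (Fin d)) :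
    Integrable (fun s => logisticLoss (inner ℝ θ s.1) s.2) P := by
  have := h.isProbabilityMeasure
  have hc : Continuous fun s : EuclideanSpace ℝ (Fin d) × ℝ =>
      logisticLoss (inner ℝ θ s.1) s.2 := by
    exact Continuous.logisticLoss (by fun_prop) (by fun_prop)
  refine ((integrable_const (Real.log 2)).add (h.integrable_inner θ).abs).mono'
    hc.aestronglyMeasurable ?_
  filter_upwards [h.ae_abs_label] with s hs
  rw [Real.norm_eq_abs, abs_of_nonneg (logisticLoss_nonneg _ _), Pi.add_apply]
  have h1 := le_of_abs_le (abs_logisticLoss_sub_le hs (inner ℝ θ s.1) 0)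
  have h2 : logisticLoss 0 s.2 = Real.log 2 := by simp [logisticLoss]; norm_num
  rw [sub_zero, h2] at h1
  linarith

theorem GaussianModel.integrable_score (h : GaussianModel a b d lam P)
    (θ u : EuclideanSpace ℝ (Fin d)) :
    Integrable (fun s => s.2 * Real.sigmoid (-(s.2 * inner ℝ θ s.1)) * inner ℝ u s.1) P := by
  have hc : Continuous fun s : EuclideanSpace ℝ (Fin d) × ℝ =>
      s.2 * Real.sigmoid (-(s.2 * inner ℝ θ s.1)) * inner ℝ u s.1 :=
    (continuous_snd.mul (Continuous.realSigmoid (by fun_prop))).mul (by fun_prop)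
  refine (h.integrable_inner u).abs.mono' hc.aestronglyMeasurable ?_
  filter_upwards [h.ae_abs_label] with s hs
  rw [Real.norm_eq_abs, abs_mul]
  exact mul_le_of_le_one_left (abs_nonneg _) (abs_mul_sigmoid_le hs _)

theorem GaussianModel.integrable_sq_mul_exp (h : GaussianModel a b d lam P)
    {u : EuclideanSpace ℝ (Fin d)} (hu : ‖u‖ = 1) {m : ℝ} (hm : 1 ≤ m) :
    Integrable (fun s => (|inner ℝ u s.1| + m) ^ 2 * Real.exp (|inner ℝ u s.1| + m)) P :=
  ((h.integrable_exp_sq_inner hu).const_mul (16 * m ^ 2 * Real.exp (m + 1))).mono'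
    (by fun_prop) (ae_of_all _ fun s => by
      rw [Real.norm_eq_abs, abs_of_nonneg (by positivity)]
      exact abs_add_sq_mul_exp_le hm _)

theorem GaussianModel.integral_sq_mul_exp_le (h : GaussianModel a b d lam P)
    {u : EuclideanSpace ℝ (Fin d)} (hu : ‖u‖ = 1) {m : ℝ} (hm : 1 ≤ m) :
    ∫ s, (|inner ℝ u s.1| + m) ^ 2 * Real.exp (|inner ℝ u s.1| + m) ∂P ≤
      16 * m ^ 2 * Real.exp (m + 1) * gaussianExpMoment := by
  rw [← h.integral_exp_sq_inner hu, ← integral_const_mul]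
  exact integral_mono (h.integrable_sq_mul_exp hu hm)
    ((h.integrable_exp_sq_inner hu).const_mul _) fun s => abs_add_sq_mul_exp_le hm _

theorem nonneg_of_forall_add_mul_nonneg {A B : ℝ} (h : ∀ t, 0 < t → t ≤ 1 → 0 ≤ A + t * B) :
    0 ≤ A := by
  have hc : Tendsto (fun t : ℝ => A + t * B) (nhdsWithin 0 (Set.Ioi 0)) (nhds (A + 0 * B)) :=
    ((continuous_const.add (continuous_id.mul continuous_const)).tendsto 0).mono_left
      nhdsWithin_le_nhds
  rw [zero_mul, add_zero] at hc
  refine ge_of_tendsto hc ?_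
  filter_upwards [Ioc_mem_nhdsGT (zero_lt_one (α := ℝ))] with t ht
  exact h t ht.1 ht.2

/-- No differentiation under the integral: the quadratic upper bound for the Bregman divergence
places the loss at `θ + t • u` below its tangent plus `O(t ^ 2)`. Minimality, division by `t` and `t
→ 0` give the inequality. -/
theorem GaussianModel.stationary (h : GaussianModel a b d lam P) {θ u : EuclideanSpace ℝ (Fin d)}
    (hθ : IsMinOn (populationLoss lam P) Set.univ θ) (hu : ‖u‖ = 1) :
    ∫ s, s.2 * Real.sigmoid (-(s.2 * inner ℝ θ s.1)) * inner ℝ u s.1 ∂P ≤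
      lam * inner ℝ θ u := by
  have := h.isProbabilityMeasure
  set D := ∫ s, s.2 * Real.sigmoid (-(s.2 * inner ℝ θ s.1)) * inner ℝ u s.1 ∂P with hD
  set Q := ∫ s, (|inner ℝ u s.1| + 1) ^ 2 * Real.exp (|inner ℝ u s.1| + 1) ∂P with hQ
  suffices 0 ≤ lam * inner ℝ θ u - D by linarith
  refine nonneg_of_forall_add_mul_nonneg (B := Q + lam / 2) fun t ht0 ht1 => ?_
  have h1 : populationLoss lam P θ ≤ populationLoss lam P (θ + t • u) := hθ (Set.mem_univ _)
  have hnorm : ‖θ + t • u‖ ^ 2 = ‖θ‖ ^ 2 + 2 * t * inner ℝ θ u + t ^ 2 := by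
    rw [norm_add_sq_real, real_inner_smul_right, norm_smul, hu, Real.norm_eq_abs, mul_one, sq_abs]
    ring
  have h2 : ∫ s, logisticLoss (inner ℝ (θ + t • u) s.1) s.2 ∂P ≤
      ∫ s, (logisticLoss (inner ℝ θ s.1) s.2 -
        t * (s.2 * Real.sigmoid (-(s.2 * inner ℝ θ s.1)) * inner ℝ u s.1) +
        t ^ 2 * ((|inner ℝ u s.1| + 1) ^ 2 * Real.exp (|inner ℝ u s.1| + 1))) ∂P := by
    refine integral_mono_ae (h.integrable_logisticLoss _)
      (((h.integrable_logisticLoss θ).sub ((h.integrable_score θ u).const_mul t)).add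
        ((h.integrable_sq_mul_exp hu le_rfl).const_mul (t ^ 2))) ?_
    filter_upwards [h.ae_abs_label] with s hs
    have h3 := logisticBregman_le (z := inner ℝ θ s.1) (h := t * inner ℝ u s.1) hs
    rw [logisticBregman] at h3
    have h4 : (t * inner ℝ u s.1) ^ 2 * Real.exp |t * inner ℝ u s.1| ≤
        t ^ 2 * ((|inner ℝ u s.1| + 1) ^ 2 * Real.exp (|inner ℝ u s.1| + 1)) := by
      rw [mul_pow, mul_assoc, abs_mul, abs_of_pos ht0]
      have h0 := abs_nonneg (inner ℝ u s.1)
      refine mul_le_mul_of_nonneg_left (mul_le_mul ?_ (Real.exp_le_exp.2 (by nlinarith))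
        (Real.exp_pos _).le (by positivity)) (by positivity)
      rw [← sq_abs]
      nlinarith
    have h5 : inner ℝ (θ + t • u) s.1 = inner ℝ θ s.1 + t * inner ℝ u s.1 := by
      rw [inner_add_left, real_inner_smul_left]
    rw [h5]
    linarith
  rw [integral_sub_add (h.integrable_logisticLoss θ) ((h.integrable_score θ u).const_mul t)
    ((h.integrable_sq_mul_exp hu le_rfl).const_mul (t ^ 2)), integral_const_mul, integral_const_mul] at h2
  rw [← hD, ← hQ] at h2
  rw [populationLoss, populationLoss, hnorm] at h1
  have h6 : 0 ≤ t * (lam * inner ℝ θ u - D + t * (Q + lam / 2)) := by nlinarith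
  exact nonneg_of_mul_nonneg_right h6 ht0

/-- Stationarity in the direction `-θ / ‖θ‖`. This is what makes the later constants independent of
`lam`. -/
theorem GaussianModel.lam_mul_norm_le (h : GaussianModel a b d lam P)
    {θ : EuclideanSpace ℝ (Fin d)} (hθ : IsMinOn (populationLoss lam P) Set.univ θ) :
    lam * ‖θ‖ ≤ gaussianExpMoment := by
  rcases eq_or_ne θ 0 with rfl | h0
  · simpa using zero_le_one.trans one_le_gaussianExpMoment
  have hn := norm_pos_iff.2 h0
  set u := (-‖θ‖⁻¹) • θ with hu_def
  have hu : ‖u‖ = 1 := by simp [u, norm_smul, hn.ne']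
  have h1 := h.stationary hθ hu
  have h2 : inner ℝ θ u = -‖θ‖ := by
    rw [hu_def, real_inner_smul_right, real_inner_self_eq_norm_sq]; field_simp
  have h3 : -∫ s, |inner ℝ u s.1| ∂P ≤
      ∫ s, s.2 * Real.sigmoid (-(s.2 * inner ℝ θ s.1)) * inner ℝ u s.1 ∂P := by
    rw [← integral_neg]
    refine integral_mono_ae (h.integrable_inner u).abs.neg (h.integrable_score θ u) ?_
    filter_upwards [h.ae_abs_label] with s hs
    refine (neg_le_neg ?_).trans (neg_abs_le _)
    rw [abs_mul]
    exact mul_le_of_le_one_left (abs_nonneg _) (abs_mul_sigmoid_le hs _)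
  rw [h2] at h1
  linarith [h.integral_abs_inner_le hu]

/-! ### Growth of the training loss around the population optimum -/

/-- The increment of the loss of a sample from `θ` to `θ + u`, up to the second order term of the
regularization. -/
def lossIncrement (lam : ℝ) (θ u : EuclideanSpace ℝ (Fin d))
    (s : EuclideanSpace ℝ (Fin d) × ℝ) : ℝ :=
  logisticLoss (inner ℝ (θ + u) s.1) s.2 - logisticLoss (inner ℝ θ s.1) s.2 + lam * inner ℝ θ u

theorem continuous_lossIncrement (lam : ℝ) (θ u : EuclideanSpace ℝ (Fin d)) :
    Continuous (lossIncrement lam θ u) :=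
  ((Continuous.logisticLoss (by fun_prop) (by fun_prop)).sub
    (Continuous.logisticLoss (by fun_prop) (by fun_prop))).add continuous_const

theorem abs_lossIncrement_sub_le (hlam : 0 < lam) (θ u v : EuclideanSpace ℝ (Fin d))
    {s : EuclideanSpace ℝ (Fin d) × ℝ} (hs : |s.2| = 1) :
    |lossIncrement lam θ u s - lossIncrement lam θ v s| ≤
      |inner ℝ (u - v) s.1| + lam * ‖θ‖ * ‖u - v‖ := by
  have e : lossIncrement lam θ u s - lossIncrement lam θ v s =
      (logisticLoss (inner ℝ (θ + u) s.1) s.2 - logisticLoss (inner ℝ (θ + v) s.1) s.2) +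
        lam * inner ℝ θ (u - v) := by
    rw [lossIncrement, lossIncrement, inner_sub_right]; ring
  rw [e]
  refine (abs_add_le _ _).trans (add_le_add ?_ ?_)
  · refine (abs_logisticLoss_sub_le hs _ _).trans (le_of_eq ?_)
    rw [← inner_sub_left, add_sub_add_left_eq_sub]
  · rw [abs_mul, abs_of_pos hlam, mul_assoc]
    exact mul_le_mul_of_nonneg_left (abs_real_inner_le_norm _ _) hlam.le

theorem abs_lossIncrement_le (hlam : 0 < lam) (θ u : EuclideanSpace ℝ (Fin d))
    {s : EuclideanSpace ℝ (Fin d) × ℝ} (hs : |s.2| = 1) :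
    |lossIncrement lam θ u s| ≤ |inner ℝ u s.1| + lam * ‖θ‖ * ‖u‖ := by
  have := abs_lossIncrement_sub_le hlam θ u 0 hs
  have h0 : lossIncrement lam θ 0 s = 0 := by simp [lossIncrement]
  rwa [h0, sub_zero, sub_zero] at this

theorem GaussianModel.integrable_lossIncrement (h : GaussianModel a b d lam P)
    (θ u : EuclideanSpace ℝ (Fin d)) : Integrable (lossIncrement lam θ u) P := by
  have := h.isProbabilityMeasure
  exact ((h.integrable_logisticLoss _).sub (h.integrable_logisticLoss _)).add (integrable_const _)

theorem exists_gaussian_scale :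
    ∃ L : ℝ, 1 ≤ L ∧ gaussianExpMoment * Real.exp (-(3 / 8 * L ^ 2)) ≤ 1 / 8 := by
  have h1 : Tendsto (fun L : ℝ => gaussianExpMoment * Real.exp (-(3 / 8 * L ^ 2))) atTop
      (nhds (gaussianExpMoment * 0)) :=
    (Real.tendsto_exp_neg_atTop_nhds_zero.comp
      ((tendsto_pow_atTop two_ne_zero).const_mul_atTop (by norm_num))).const_mul _
  rw [mul_zero] at h1
  obtain ⟨L, hL1, hL2⟩ := ((h1.eventually (gt_mem_nhds (by norm_num : (0 : ℝ) < 1 / 8))).and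
    (eventually_ge_atTop 1)).exists
  exact ⟨L, hL2, hL1.le⟩

/-- The increment is the Bregman divergence plus the first order terms, whose mean is nonnegative by
stationarity. The divergence is at least `c` on the event `G` that both scores are bounded and the
one along `u` is not small, and `G` has probability at least `3 / 8` uniformly in the model. -/
theorem exists_integral_lossIncrement_ge (b : ℝ) :
    ∃ κ > 0, ∀ (a lam : ℝ) (d : ℕ) (P : Measure (EuclideanSpace ℝ (Fin d) × ℝ)),
      GaussianModel a b d lam P → ∀ θ u : EuclideanSpace ℝ (Fin d),
      IsMinOn (populationLoss lam P) Set.univ θ → ‖θ‖ ≤ b → ‖u‖ = 1 →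
      κ ≤ ∫ s, lossIncrement lam θ u s ∂P := by
  obtain ⟨L, hL1, hL⟩ := exists_gaussian_scale
  have hL0 : 0 < L := by linarith
  obtain ⟨c, hc0, hc⟩ := exists_logisticBregman_lower_bound ((|b| + 1) * L) (1 / 8) (by norm_num)
  refine ⟨c * (3 / 8), by positivity, fun a lam d P h θ u hθ hθb hu => ?_⟩
  have := h.isProbabilityMeasure
  have hst := h.stationary hθ hu
  have hM : L ≤ (|b| + 1) * L := by nlinarith [abs_nonneg b]
  set G : Set (EuclideanSpace ℝ (Fin d) × ℝ) :=
    {s | |inner ℝ θ s.1| ≤ (|b| + 1) * L ∧ 1 / 8 ≤ |inner ℝ u s.1| ∧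
      |inner ℝ u s.1| ≤ (|b| + 1) * L} with hG
  have hGm : MeasurableSet G := by
    have h1 : Measurable fun s : EuclideanSpace ℝ (Fin d) × ℝ => |inner ℝ θ s.1| := by fun_prop
    have h2 : Measurable fun s : EuclideanSpace ℝ (Fin d) × ℝ => |inner ℝ u s.1| := by fun_prop
    exact (measurableSet_le h1 measurable_const).inter
      ((measurableSet_le measurable_const h2).inter (measurableSet_le h2 measurable_const))
  have htail : ∀ w : EuclideanSpace ℝ (Fin d), ‖w‖ = 1 →
      P.real {s | L < |inner ℝ w s.1|} ≤ 1 / 8 := fun w hw =>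
    (h.measureReal_inner_mem hw (A := {x | L < |x|})
      (measurableSet_lt measurable_const (by fun_prop))).le.trans
      ((gaussianReal_lt_abs_le hL0.le).trans hL)
  have hsmall : P.real {s | |inner ℝ u s.1| < 1 / 8} ≤ 1 / 4 :=
    (h.measureReal_inner_mem hu (A := {x | |x| < 1 / 8})
      (measurableSet_lt (by fun_prop) measurable_const)).le.trans
      ((gaussianReal_abs_lt_le (by norm_num)).trans (by norm_num))
  have hθtail : P.real {s | (|b| + 1) * L < |inner ℝ θ s.1|} ≤ 1 / 8 := by
    rcases eq_or_ne θ 0 with rfl | h0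
    · have : {s : EuclideanSpace ℝ (Fin d) × ℝ |
          (|b| + 1) * L < |inner ℝ (0 : EuclideanSpace ℝ (Fin d)) s.1|} = ∅ := by
        ext s
        simp only [inner_zero_left, abs_zero, Set.mem_ofPred_eq, Set.mem_empty_iff_false,
          iff_false, not_lt]
        positivity
      rw [this, measureReal_empty]; norm_num
    · have hn := norm_pos_iff.2 h0
      refine le_trans (measureReal_mono fun s hs => ?_)
        (htail (‖θ‖⁻¹ • θ) (by simp [norm_smul, hn.ne']))
      simp only [Set.mem_ofPred_eq] at hs ⊢
      rw [real_inner_smul_left, abs_mul, abs_inv, abs_norm, lt_inv_mul_iff₀ hn]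
      refine lt_of_le_of_lt ?_ hs
      exact mul_le_mul_of_nonneg_right (by linarith [le_abs_self b]) hL0.le
  -- The three ways to fail cost `1 / 8`, `1 / 4` and `1 / 8`.
  have hGc : P.real Gᶜ ≤ 1 / 2 := by
    have hsub : Gᶜ ⊆ ({s | (|b| + 1) * L < |inner ℝ θ s.1|} ∪ {s | |inner ℝ u s.1| < 1 / 8}) ∪
        {s | L < |inner ℝ u s.1|} := by
      intro s hs
      by_contra hcon
      simp only [Set.mem_union, Set.mem_ofPred_eq, not_or, not_lt] at hcon
      exact hs ⟨hcon.1.1, hcon.1.2, hcon.2.trans hM⟩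
    refine (measureReal_mono hsub).trans ((measureReal_union_le _ _).trans ?_)
    have := measureReal_union_le (μ := P) {s | (|b| + 1) * L < |inner ℝ θ s.1|}
      {s | |inner ℝ u s.1| < 1 / 8}
    linarith [htail u hu]
  have hGr : 3 / 8 ≤ P.real G := by
    have := probReal_add_probReal_compl (μ := P) hGm
    linarith
  have hlow : ∫ s, (G.indicator (fun _ => c) s -
      s.2 * Real.sigmoid (-(s.2 * inner ℝ θ s.1)) * inner ℝ u s.1 + lam * inner ℝ θ u) ∂P ≤
      ∫ s, lossIncrement lam θ u s ∂P := by
    refine integral_mono_ae ((((integrable_const c).indicator hGm).sub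
      (h.integrable_score θ u)).add (integrable_const _)) (h.integrable_lossIncrement θ u) ?_
    filter_upwards [h.ae_abs_label] with s hs
    have h1 : G.indicator (fun _ => c) s ≤
        logisticBregman (inner ℝ θ s.1) (inner ℝ u s.1) s.2 := by
      by_cases hsG : s ∈ G
      · rw [Set.indicator_of_mem hsG]
        exact hc _ _ _ hsG.1 hsG.2.1 hsG.2.2 hs
      · rw [Set.indicator_of_notMem hsG]
        exact logisticBregman_nonneg _ _ _
    rw [logisticBregman] at h1
    rw [lossIncrement, inner_add_left]
    linarith
  rw [integral_sub_add ((integrable_const c).indicator hGm) (h.integrable_score θ u)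
    (integrable_const _), integral_indicator_const _ hGm] at hlow
  simp only [integral_const, probReal_univ, smul_eq_mul] at hlow
  nlinarith

theorem exists_measureReal_pi_sum_lossIncrement_le (b : ℝ) :
    ∃ κ > 0, ∃ r > 0, ∀ (a lam : ℝ) (d : ℕ) (P : Measure (EuclideanSpace ℝ (Fin d) × ℝ)),
      GaussianModel a b d lam P → ∀ θ u : EuclideanSpace ℝ (Fin d),
      IsMinOn (populationLoss lam P) Set.univ θ → ‖θ‖ ≤ b → ‖u‖ = 1 → ∀ n : ℕ,
      (Measure.pi fun _ : Fin n => P).real {S | ∑ i, lossIncrement lam θ u (S i) ≤ n * κ} ≤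
        Real.exp (-(n * r)) := by
  obtain ⟨κ, hκ0, hκ⟩ := exists_integral_lossIncrement_ge b
  set m := gaussianExpMoment with hm_def
  have hm1 : 1 ≤ m := one_le_gaussianExpMoment
  set Q := 16 * m ^ 2 * Real.exp (m + 1) * m with hQ
  have hQ0 : 0 < Q := by positivity
  -- `Q` bounds the second order remainder of `exp (-t X)` divided by `t ^ 2`. For this `t` it
  -- consumes half of the drift `t κ`.
  obtain ⟨t, ht0, ht1, htQ⟩ : ∃ t : ℝ, 0 < t ∧ t ≤ 1 ∧ t * Q ≤ κ / 2 := by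
    refine ⟨min 1 (κ / 2 / Q), by positivity, min_le_left _ _, ?_⟩
    calc _ ≤ κ / 2 / Q * Q := mul_le_mul_of_nonneg_right (min_le_right _ _) hQ0.le
      _ = κ / 2 := div_mul_cancel₀ _ hQ0.ne'
  refine ⟨κ / 4, by positivity, t * κ / 4, by positivity, fun a lam d P h θ u hθ hθb hu n => ?_⟩
  have := h.isProbabilityMeasure
  set X := lossIncrement lam θ u with hX
  have hXc : Continuous X := continuous_lossIncrement lam θ u
  have hXi : Integrable X P := h.integrable_lossIncrement θ u
  have hXle : ∀ᵐ s ∂P, |X s| ≤ |inner ℝ u s.1| + m := by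
    filter_upwards [h.ae_abs_label] with s hs
    have h1 := abs_lossIncrement_le h.lam_pos θ u hs
    rw [hu, mul_one] at h1
    linarith [h.lam_mul_norm_le hθ]
  have hW := h.integrable_sq_mul_exp hu hm1
  have hexp : ∀ᵐ s ∂P, Real.exp (-t * X s) ≤
      1 - t * X s + t ^ 2 * ((|inner ℝ u s.1| + m) ^ 2 * Real.exp (|inner ℝ u s.1| + m)) := by
    filter_upwards [hXle] with s hs
    have h1 := exp_le_one_add_add (-t * X s)
    have h2 : (-t * X s) ^ 2 * Real.exp |-t * X s| ≤
        t ^ 2 * ((|inner ℝ u s.1| + m) ^ 2 * Real.exp (|inner ℝ u s.1| + m)) := by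
      rw [mul_pow, neg_sq, mul_assoc, abs_mul, abs_neg, abs_of_pos ht0, ← sq_abs (X s)]
      refine mul_le_mul_of_nonneg_left (mul_le_mul (pow_le_pow_left₀ (abs_nonneg _) hs 2)
        (Real.exp_le_exp.2 ?_) (Real.exp_pos _).le (by positivity)) (by positivity)
      exact (mul_le_of_le_one_left (abs_nonneg _) ht1).trans hs
    linarith
  have hint2 : Integrable (fun s => 1 - t * X s + t ^ 2 *
      ((|inner ℝ u s.1| + m) ^ 2 * Real.exp (|inner ℝ u s.1| + m))) P :=
    ((integrable_const 1).sub (hXi.const_mul t)).add (hW.const_mul (t ^ 2))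
  have hint : Integrable (fun s => Real.exp (-t * X s)) P := by
    refine hint2.mono' (by fun_prop) ?_
    filter_upwards [hexp] with s hs
    rwa [Real.norm_eq_abs, Real.abs_exp]
  have hle : ∫ s, Real.exp (-t * X s) ∂P ≤ Real.exp (-(t * κ / 2)) := by
    refine (integral_mono_ae hint hint2 hexp).trans ?_
    rw [integral_sub_add (integrable_const 1) (hXi.const_mul t) (hW.const_mul (t ^ 2)),
      integral_const_mul, integral_const_mul]
    simp only [integral_const, probReal_univ, one_smul]
    have h1 := hκ a lam d P h θ u hθ hθb hu
    have h2 := h.integral_sq_mul_exp_le hu hm1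
    have h3 := Real.add_one_le_exp (-(t * κ / 2))
    have h4 : t ^ 2 * ∫ s, (|inner ℝ u s.1| + m) ^ 2 * Real.exp (|inner ℝ u s.1| + m) ∂P ≤
        t * (κ / 2) := by
      calc _ ≤ t ^ 2 * Q := mul_le_mul_of_nonneg_left h2 (sq_nonneg t)
        _ = t * (t * Q) := by ring
        _ ≤ _ := mul_le_mul_of_nonneg_left htQ ht0.le
    have h5 := mul_le_mul_of_nonneg_left h1 ht0.le
    linarith
  have key := measureReal_pi_sum_ge_le P n (t := -(t * (n * (κ / 4)))) hint hle
  refine le_trans (measureReal_mono fun S hS => ?_) (key.trans (Real.exp_le_exp.2 ?_))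
  · simp only [Set.mem_ofPred_eq] at hS ⊢
    rw [← Finset.mul_sum]
    have := mul_le_mul_of_nonneg_left hS ht0.le
    linarith
  · linarith

/-- The mean increment is Lipschitz in `u` with constant at most `1 + K + m`: first absolute moments
follow from third ones by `x ≤ 1 + x ^ 3`, and the regularization contributes `lam * ‖θ‖`. The
choice of `ε` makes the loss between net points at most `κ`. -/
theorem sum_lossIncrement_pos_of_net {n : ℕ} {S : Fin n → EuclideanSpace ℝ (Fin d) × ℝ}
    {N : Finset (EuclideanSpace ℝ (Fin d))} {θ : EuclideanSpace ℝ (Fin d)} {K κ ε m : ℝ}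
    (hlam : 0 < lam) (hK : 0 ≤ K) (hy : ∀ i, |(S i).2| = 1)
    (hcube : ∀ u : EuclideanSpace ℝ (Fin d), ∑ i, |inner ℝ u (S i).1| ^ 3 ≤ K * n * ‖u‖ ^ 3)
    (hm : lam * ‖θ‖ ≤ m) (hε : ε * (1 + K + m) ≤ κ)
    (hN : ∀ u : EuclideanSpace ℝ (Fin d), ‖u‖ = 1 → ∃ v ∈ N, ‖u - v‖ ≤ ε)
    (hκ : ∀ v ∈ N, n * κ < ∑ i, lossIncrement lam θ v (S i))
    {u : EuclideanSpace ℝ (Fin d)} (hu : ‖u‖ = 1) :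
    0 < ∑ i, lossIncrement lam θ u (S i) := by
  obtain ⟨v, hv, huv⟩ := hN u hu
  have habs : ∑ i, |inner ℝ (u - v) (S i).1| ≤ (1 + K) * n * ‖u - v‖ := by
    rcases eq_or_ne (u - v) 0 with h0 | h0
    · simp [h0]
    have hn := norm_pos_iff.2 h0
    have h1 := hcube (‖u - v‖⁻¹ • (u - v))
    have h2 : ‖‖u - v‖⁻¹ • (u - v)‖ = 1 := by simp [norm_smul, hn.ne']
    rw [h2, one_pow, mul_one] at h1
    have h3 : ∑ i, |inner ℝ (‖u - v‖⁻¹ • (u - v)) (S i).1| ≤ (1 + K) * n := by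
      calc _ ≤ ∑ i, (1 + |inner ℝ (‖u - v‖⁻¹ • (u - v)) (S i).1| ^ 3) := by
            refine Finset.sum_le_sum fun i _ => ?_
            set x := |inner ℝ (‖u - v‖⁻¹ • (u - v)) (S i).1|
            have hx : 0 ≤ x := abs_nonneg _
            nlinarith [mul_nonneg hx (sq_nonneg (x - 1)), sq_nonneg (x - 1)]
        _ ≤ _ := by
            rw [Finset.sum_add_distrib]
            simp only [Finset.sum_const, Finset.card_univ, Fintype.card_fin, nsmul_eq_mul, mul_one]
            linarith
    have e : ∀ i, |inner ℝ (‖u - v‖⁻¹ • (u - v)) (S i).1| =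
        ‖u - v‖⁻¹ * |inner ℝ (u - v) (S i).1| := fun i => by
      rw [real_inner_smul_left, abs_mul, abs_inv, abs_norm]
    simp only [e, ← Finset.mul_sum] at h3
    rw [inv_mul_le_iff₀ hn] at h3
    linarith
  have h1 : ∑ i, lossIncrement lam θ v (S i) - ∑ i, lossIncrement lam θ u (S i) ≤
      ∑ i, |inner ℝ (u - v) (S i).1| + n * (lam * ‖θ‖ * ‖u - v‖) := by
    rw [← Finset.sum_sub_distrib]
    refine (Finset.sum_le_sum (g := fun i => |inner ℝ (u - v) (S i).1| + lam * ‖θ‖ * ‖u - v‖)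
      fun i _ => ?_).trans (le_of_eq ?_)
    · refine le_trans (le_abs_self _) ?_
      rw [abs_sub_comm]
      exact abs_lossIncrement_sub_le hlam θ u v (hy i)
    · simp [Finset.sum_add_distrib]
  have h2 := hκ v hv
  have hn0 : (0 : ℝ) ≤ n := n.cast_nonneg
  have h3 : lam * ‖θ‖ * ‖u - v‖ ≤ m * ‖u - v‖ := mul_le_mul_of_nonneg_right hm (norm_nonneg _)
  have hm0 : 0 ≤ m := le_trans (by positivity) hm
  have h4 : (1 + K + m) * ‖u - v‖ ≤ κ := by
    refine le_trans (mul_le_mul_of_nonneg_left huv (by positivity)) ?_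
    linarith
  nlinarith [mul_le_mul_of_nonneg_left h4 hn0, mul_le_mul_of_nonneg_left h3 hn0]

theorem logisticLoss_convex {t : ℝ} (h0 : 0 ≤ t) (h1 : t ≤ 1) (z w y : ℝ) :
    logisticLoss ((1 - t) * z + t * w) y ≤
      (1 - t) * logisticLoss z y + t * logisticLoss w y := by
  have hz := logisticLoss_tangent_le ((1 - t) * z + t * w) z y
  have hw := logisticLoss_tangent_le ((1 - t) * z + t * w) w y
  have h2 := mul_le_mul_of_nonneg_left hz (sub_nonneg.2 h1)
  have h3 := mul_le_mul_of_nonneg_left hw h0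
  linarith

theorem trainingLoss_convex {n : ℕ} (hlam : 0 < lam) (S : Fin n → EuclideanSpace ℝ (Fin d) × ℝ)
    {t : ℝ} (h0 : 0 ≤ t) (h1 : t ≤ 1) (θ θ' : EuclideanSpace ℝ (Fin d)) :
    trainingLoss lam S ((1 - t) • θ + t • θ') ≤
      (1 - t) * trainingLoss lam S θ + t * trainingLoss lam S θ' := by
  have hs : ∑ i, logisticLoss (inner ℝ ((1 - t) • θ + t • θ') (S i).1) (S i).2 ≤
      (1 - t) * ∑ i, logisticLoss (inner ℝ θ (S i).1) (S i).2 +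
        t * ∑ i, logisticLoss (inner ℝ θ' (S i).1) (S i).2 := by
    rw [Finset.mul_sum, Finset.mul_sum, ← Finset.sum_add_distrib]
    refine Finset.sum_le_sum fun i _ => ?_
    rw [inner_add_left, real_inner_smul_left, real_inner_smul_left]
    exact logisticLoss_convex h0 h1 _ _ _
  have hq : ‖(1 - t) • θ + t • θ'‖ ^ 2 ≤ (1 - t) * ‖θ‖ ^ 2 + t * ‖θ'‖ ^ 2 := by
    have e : ‖(1 - t) • θ + t • θ'‖ ≤ (1 - t) * ‖θ‖ + t * ‖θ'‖ := by
      refine (norm_add_le _ _).trans (le_of_eq ?_)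
      rw [norm_smul, norm_smul, Real.norm_of_nonneg (sub_nonneg.2 h1), Real.norm_of_nonneg h0]
    refine (pow_le_pow_left₀ (norm_nonneg _) e 2).trans ?_
    nlinarith [mul_nonneg (mul_nonneg h0 (sub_nonneg.2 h1)) (sq_nonneg (‖θ‖ - ‖θ'‖))]
  have hc : 0 ≤ (n : ℝ) * lam / 2 := by positivity
  unfold trainingLoss
  nlinarith [mul_le_mul_of_nonneg_left hq hc]

/-- If the minimizer were at distance more than `1` from `θ`, convexity would give a point of the
unit sphere around `θ` with loss at most that of `θ`. There the loss is strictly larger, the omitted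
quadratic term being nonnegative. -/
theorem norm_trainedModel_le {n : ℕ} (hlam : 0 < lam) (hn : 0 < n)
    (S : Fin n → EuclideanSpace ℝ (Fin d) × ℝ) (θ : EuclideanSpace ℝ (Fin d))
    (hpos : ∀ u : EuclideanSpace ℝ (Fin d), ‖u‖ = 1 → 0 < ∑ i, lossIncrement lam θ u (S i)) :
    ‖trainedModel lam S‖ ≤ ‖θ‖ + 1 := by
  by_contra! hcon
  set θ' := trainedModel lam S with hθ'
  have h1 : 1 < ‖θ' - θ‖ := by linarith [norm_sub_norm_le θ' θ]
  have h0 : 0 < ‖θ' - θ‖ := by linarith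
  set t := ‖θ' - θ‖⁻¹ with ht
  have ht0 : 0 ≤ t := by positivity
  have ht1 : t ≤ 1 := inv_le_one_of_one_le₀ h1.le
  set u := t • (θ' - θ) with hu
  have hu1 : ‖u‖ = 1 := by rw [hu, norm_smul, ht]; simp [h0.ne']
  have h2 := trainingLoss_convex hlam S ht0 ht1 θ θ'
  have h3 : trainingLoss lam S θ' ≤ trainingLoss lam S θ :=
    isMinOn_trainedModel hlam hn S (Set.mem_univ _)
  have e : (1 - t) • θ + t • θ' = θ + u := by rw [hu]; module
  rw [e] at h2
  have h4 : trainingLoss lam S (θ + u) ≤ trainingLoss lam S θ := by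
    nlinarith [mul_le_mul_of_nonneg_left h3 ht0]
  have h5 := hpos u hu1
  have hnorm : ‖θ + u‖ ^ 2 = ‖θ‖ ^ 2 + 2 * inner ℝ θ u + 1 := by
    rw [norm_add_sq_real, hu1]; ring
  simp only [lossIncrement, Finset.sum_add_distrib, Finset.sum_sub_distrib, Finset.sum_const,
    Finset.card_univ, Fintype.card_fin, nsmul_eq_mul] at h5
  unfold trainingLoss at h4
  rw [hnorm] at h4
  have hc : 0 ≤ (n : ℝ) * lam := by positivity
  nlinarith

end Growth

/-! ### The bounds on typical training sets -/

/-- The conclusion about a training set `S`: lower bound for the average of the existing bound, and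
two-sided bounds for its ingredients. -/
def SatisfiesBounds {n d : ℕ} (c C : ℝ) (p k : ℕ) (lam : ℝ)
    (S : Fin n → EuclideanSpace ℝ (Fin d) × ℝ) : Prop :=
  c * ((k : ℝ) ^ 2 * d / ((n : ℝ) ^ 2 * lam ^ 3)) ≤ averageExistingBound lam S k ∧
  (∀ T : Finset (Fin n), T.card = k →
    (c * n ≤ cLip lam S T ∧ cLip lam S T ≤ C * n) ∧
    (c * (1 / (lam * n)) ≤ cOp lam S T ∧ cOp lam S T ≤ C * (1 / (lam * n)))) ∧
  c * √d ≤ cGrad lam S ∧ cGrad lam S ≤ C * Real.log n ^ p * √d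

theorem le_averageExistingBound {n d k : ℕ} {lam c : ℝ}
    {S : Fin n → EuclideanSpace ℝ (Fin d) × ℝ} (hlam : 0 < lam) (hn : 0 < n) (hk : k ≤ n)
    (hc : 0 ≤ c) (hLip : ∀ T : Finset (Fin n), T.card = k → c * n ≤ cLip lam S T)
    (hOp : ∀ T : Finset (Fin n), T.card = k → c * (1 / (lam * n)) ≤ cOp lam S T)
    (hGrad : c * √d ≤ cGrad lam S) :
    c ^ 6 * ((k : ℝ) ^ 2 * d / ((n : ℝ) ^ 2 * lam ^ 3)) ≤ averageExistingBound lam S k := by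
  have hch : (0 : ℝ) < n.choose k := by exact_mod_cast Nat.choose_pos hk
  have hn' : (0 : ℝ) < n := by exact_mod_cast hn
  rw [averageExistingBound, le_div_iff₀ hch]
  have key : ∀ T ∈ Finset.powersetCard k (Finset.univ : Finset (Fin n)),
      c ^ 6 * ((k : ℝ) ^ 2 * d / ((n : ℝ) ^ 2 * lam ^ 3)) ≤ existingBound lam S T := by
    intro T hT
    have hTk := (Finset.mem_powersetCard.1 hT).2
    rw [existingBound, hTk]
    calc _ = (c * n) * (c * (1 / (lam * n))) ^ 3 * (k : ℝ) ^ 2 * (c * √d) ^ 2 := by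
          rw [mul_pow c (√d), Real.sq_sqrt d.cast_nonneg]
          field_simp
      _ ≤ _ := by
          have h1 := hLip T hTk
          have h2 := hOp T hTk
          have h0 : 0 ≤ cLip lam S T := le_trans (by positivity) h1
          have h3 : (c * (1 / (lam * n))) ^ 3 ≤ cOp lam S T ^ 3 :=
            pow_le_pow_left₀ (by positivity) h2 3
          have h4 : (c * √d) ^ 2 ≤ cGrad lam S ^ 2 := pow_le_pow_left₀ (by positivity) hGrad 2
          exact mul_le_mul (mul_le_mul_of_nonneg_right (mul_le_mul h1 h3 (by positivity) h0)
            (by positivity)) h4 (by positivity) (mul_nonneg (mul_nonneg h0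
              (le_trans (by positivity) h3)) (by positivity))
  have := Finset.card_nsmul_le_sum _ _ _ key
  rw [Finset.card_powersetCard, Finset.card_univ, Fintype.card_fin, nsmul_eq_mul] at this
  linarith

theorem satisfiesBounds_of_typical {n d k : ℕ} {lam K B M δ δ' c : ℝ}
    {S : Fin n → EuclideanSpace ℝ (Fin d) × ℝ} (hlam : 0 < lam) (hn : 0 < n) (j₀ : Fin d)
    (hK : 2 ≤ K) (hM : 0 < M) (hδ' : 0 < δ') (hδ : δ' ≤ δ) (hδ1 : δ ≤ 1)
    (hMB : 2 * K * B ^ 3 ≤ δ * M ^ 3) (hk : (k : ℝ) ≤ δ / 2 * n)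
    (hc0 : 0 ≤ c) (hc1 : c ≤ 1) (hcLip : c ≤ δ / 2 * ((Real.sigmoid (1 / 8) - 1 / 2) ^ 2 / 64))
    (hcGrad : c ≤ √(δ' / 2 * (Real.sigmoid (-M) / 32) ^ 2))
    (hy : ∀ i, |(S i).2| = 1) (hne : ∀ i, (S i).1 j₀ ≠ 0)
    (hnorm : ∀ i, ‖(S i).1‖ ≤ Real.log n * √d)
    (hcube : ∀ u : EuclideanSpace ℝ (Fin d), ∑ i, |inner ℝ u (S i).1| ^ 3 ≤ K * n * ‖u‖ ^ 3)
    (hbig : ∀ j, δ * n ≤ ((Finset.univ.filter fun i => 1 / 8 ≤ |(S i).1 j|).card : ℝ))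
    (hsmall : ∀ j, δ' * n ≤
      ((Finset.univ.filter fun i => |(S i).1 j| ≤ Real.sigmoid (-M) / 32).card : ℝ))
    (hθ : ‖trainedModel lam S‖ ≤ B) :
    SatisfiesBounds (c ^ 6) K 1 k lam S := by
  have hn' : (0 : ℝ) < n := by exact_mod_cast hn
  have hK0 : 0 ≤ K := by linarith
  have hk2 : (k : ℝ) ≤ n / 2 := by nlinarith
  have hkn : k ≤ n := by
    have : (k : ℝ) ≤ n := by linarith
    exact_mod_cast this
  -- The product in the existing bound collects `c * c ^ 3 * c ^ 2`; as `c ≤ 1`, the constant `c ^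
  -- 6` also serves for the single factors.
  have hc6 : c ^ 6 ≤ c := pow_le_of_le_one hc0 hc1 (by norm_num)
  have hcard : ∀ T : Finset (Fin n), T.card = k → (Tᶜ.card : ℝ) = n - k := by
    intro T hT
    rw [Finset.card_compl, Fintype.card_fin, hT, Nat.cast_sub hkn]
  have hpos : ∀ T : Finset (Fin n), T.card = k → 0 < Tᶜ.card := by
    intro T hT
    have : (0 : ℝ) < Tᶜ.card := by rw [hcard T hT]; linarith
    exact_mod_cast this
  have hLip : ∀ T : Finset (Fin n), T.card = k → c * n ≤ cLip lam S T := by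
    intro T hT
    refine le_trans (mul_le_mul_of_nonneg_right hcLip hn'.le)
      (le_cLip hK0 hy hcube j₀ (hbig j₀) (by rw [hT]; exact hk))
  have hOp : ∀ T : Finset (Fin n), T.card = k → c * (1 / (lam * n)) ≤ cOp lam S T := by
    intro T hT
    refine le_trans ?_ (le_cOp hlam hy j₀ hne (hpos T hT))
    have hTpos : (0 : ℝ) < Tᶜ.card := by exact_mod_cast hpos T hT
    have h1 : 1 / (lam * n) ≤ 1 / (Tᶜ.card * lam) := by
      refine one_div_le_one_div_of_le (by positivity) ?_
      rw [mul_comm lam]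
      refine mul_le_mul_of_nonneg_right ?_ hlam.le
      rw [hcard T hT]
      linarith [(k.cast_nonneg : (0 : ℝ) ≤ k)]
    exact (mul_le_of_le_one_left (by positivity) hc1).trans h1
  have hGrad : c * √d ≤ cGrad lam S :=
    (mul_le_mul_of_nonneg_right hcGrad (Real.sqrt_nonneg _)).trans
      (le_cGrad hn hK0 hM hδ' hδ hMB hy hcube hbig hsmall hθ)
  refine ⟨le_averageExistingBound hlam hn hkn hc0 hLip hOp hGrad, fun T hT => ⟨⟨?_, ?_⟩, ?_, ?_⟩,
    ?_, ?_⟩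
  · exact (mul_le_mul_of_nonneg_right hc6 hn'.le).trans (hLip T hT)
  · exact cLip_le hK0 hy hcube T
  · exact (mul_le_mul_of_nonneg_right hc6 (by positivity)).trans (hOp T hT)
  · refine (cOp_le hlam (hpos T hT)).trans ?_
    have h1 : (1 : ℝ) / (Tᶜ.card * lam) ≤ 1 / (n / 2 * lam) := by
      refine one_div_le_one_div_of_le (by positivity) (mul_le_mul_of_nonneg_right ?_ hlam.le)
      rw [hcard T hT]
      linarith
    refine h1.trans ?_
    have h2 : 1 / (n / 2 * lam) = 2 * (1 / (lam * n)) := by field_simp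
    rw [h2]
    exact mul_le_mul_of_nonneg_right hK (by positivity)
  · exact (mul_le_mul_of_nonneg_right hc6 (Real.sqrt_nonneg _)).trans hGrad
  · refine (cGrad_le hlam hn hy hnorm).trans ?_
    have h0 : 0 ≤ Real.log n * √d := mul_nonneg (Real.log_natCast_nonneg n) (Real.sqrt_nonneg _)
    rw [pow_one, mul_assoc]
    exact mul_le_mul_of_nonneg_right hK h0

/-! ### The probability of an atypical training set -/

theorem measureReal_biUnion_le_card_mul {α ι : Type*} [MeasurableSpace α] (μ : Measure α)
    (N : Finset ι) (A : ι → Set α) {q : ℝ} (h : ∀ u ∈ N, μ.real (A u) ≤ q) :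
    μ.real {S | ∃ u ∈ N, S ∈ A u} ≤ N.card * q := by
  have e : {S | ∃ u ∈ N, S ∈ A u} = ⋃ u ∈ N, A u := by ext S; simp
  rw [e, ← nsmul_eq_mul]
  exact (measureReal_biUnion_finset_le _ _).trans (Finset.sum_le_card_nsmul _ _ _ h)

theorem measureReal_le_of_union_bound {α : Type*} [MeasurableSpace α] {μ : Measure α}
    [IsFiniteMeasure μ] {B A₁ A₂ A₃ A₄ A₅ A₆ : Set α} {q₁ q₂ q₃ q₄ q₅ q₆ : ℝ}
    (h₁ : μ.real A₁ ≤ q₁) (h₂ : μ.real A₂ ≤ q₂) (h₃ : μ.real A₃ ≤ q₃) (h₄ : μ.real A₄ ≤ q₄)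
    (h₅ : μ.real A₅ ≤ q₅) (h₆ : μ.real A₆ ≤ q₆)
    (h : ∀ S, S ∉ A₁ → S ∉ A₂ → S ∉ A₃ → S ∉ A₄ → S ∉ A₅ → S ∉ A₆ → S ∉ B) :
    μ.real B ≤ q₁ + q₂ + q₃ + q₄ + q₅ + q₆ := by
  have hsub : B ⊆ A₁ ∪ A₂ ∪ A₃ ∪ A₄ ∪ A₅ ∪ A₆ := by
    intro S hS
    by_contra hcon
    simp only [Set.mem_union, not_or] at hcon
    obtain ⟨⟨⟨⟨⟨h1, h2⟩, h3⟩, h4⟩, h5⟩, h6⟩ := hcon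
    exact h S h1 h2 h3 h4 h5 h6 hS
  have u₁ := measureReal_union_le (μ := μ) A₁ A₂
  have u₂ := measureReal_union_le (μ := μ) (A₁ ∪ A₂) A₃
  have u₃ := measureReal_union_le (μ := μ) (A₁ ∪ A₂ ∪ A₃) A₄
  have u₄ := measureReal_union_le (μ := μ) (A₁ ∪ A₂ ∪ A₃ ∪ A₄) A₅
  have u₅ := measureReal_union_le (μ := μ) (A₁ ∪ A₂ ∪ A₃ ∪ A₄ ∪ A₅) A₆
  linarith [measureReal_mono (μ := μ) hsub]

theorem gaussianReal_le_abs_ge :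
    (3 / 4 : ℝ) ≤ (gaussianReal 0 1).real {x : ℝ | 1 / 8 ≤ |x|} := by
  have hms : MeasurableSet {x : ℝ | |x| < 1 / 8} :=
    measurableSet_lt (by fun_prop) measurable_const
  have h1 := probReal_add_probReal_compl (μ := gaussianReal 0 1) hms
  have h2 := gaussianReal_abs_lt_le (δ := 1 / 8) (by norm_num)
  have h3 : {x : ℝ | |x| < 1 / 8}ᶜ = {x : ℝ | 1 / 8 ≤ |x|} := by ext x; simp
  rw [h3] at h1
  linarith

section Model

variable {a b lam : ℝ} {d : ℕ} {P : Measure (EuclideanSpace ℝ (Fin d) × ℝ)}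

theorem GaussianModel.measureReal_pi_exists_few_large (h : GaussianModel a b d lam P) (n : ℕ) :
    (Measure.pi fun _ : Fin n => P).real
      {S | ∃ j, ((Finset.univ.filter fun i => 1 / 8 ≤ |(S i).1 j|).card : ℝ) ≤
        n * (3 / 4 / 4)} ≤ d * Real.exp (-(n * (3 / 4 / 4))) := by
  have h1 := measureReal_biUnion_le_card_mul (Measure.pi fun _ : Fin n => P)
    (Finset.univ : Finset (Fin d)) _ fun j _ =>
      h.measureReal_pi_card_le j (A := {x : ℝ | 1 / 8 ≤ |x|})
        (measurableSet_le measurable_const (by fun_prop)) n gaussianReal_le_abs_ge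
  simpa only [Finset.mem_univ, true_and, Set.mem_ofPred_eq, Finset.card_univ,
    Fintype.card_fin] using h1

theorem GaussianModel.measureReal_pi_exists_few_small (h : GaussianModel a b d lam P) (n : ℕ)
    {ρ μ : ℝ} (hμ : μ ≤ (gaussianReal 0 1).real {x | |x| ≤ ρ}) :
    (Measure.pi fun _ : Fin n => P).real
      {S | ∃ j, ((Finset.univ.filter fun i => |(S i).1 j| ≤ ρ).card : ℝ) ≤ n * (μ / 4)} ≤
      d * Real.exp (-(n * (μ / 4))) := by
  have h1 := measureReal_biUnion_le_card_mul (Measure.pi fun _ : Fin n => P)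
    (Finset.univ : Finset (Fin d)) _ fun j _ =>
      h.measureReal_pi_card_le j (A := {x : ℝ | |x| ≤ ρ})
        (measurableSet_le (by fun_prop) measurable_const) n hμ
  simpa only [Finset.mem_univ, true_and, Set.mem_ofPred_eq, Finset.card_univ,
    Fintype.card_fin] using h1

theorem GaussianModel.measureReal_pi_exists_degenerate (h : GaussianModel a b d lam P)
    (j : Fin d) (n : ℕ) :
    (Measure.pi fun _ : Fin n => P).real {S | ∃ i, ¬ (|(S i).2| = 1 ∧ (S i).1 j ≠ 0)} ≤ 0 := by
  have := h.isProbabilityMeasure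
  refine (measureReal_pi_exists_le P n {s | ¬ (|s.2| = 1 ∧ s.1 j ≠ 0)}).trans (le_of_eq ?_)
  have h1 : ∀ᵐ s ∂P, |s.2| = 1 ∧ s.1 j ≠ 0 := h.ae_abs_label.and (h.ae_coordinate_ne_zero j)
  rw [ae_iff] at h1
  rw [measureReal_def, h1]
  simp

/-- On short features the truncation is inactive. -/
theorem sum_cube_le_of_truncated {n : ℕ} {S : Fin n → EuclideanSpace ℝ (Fin d) × ℝ} (hn : 0 < n)
    (hnorm : ∀ i, ‖(S i).1‖ ≤ √n / 4) {u : EuclideanSpace ℝ (Fin d)} (hu : ‖u‖ = 1) {K : ℝ}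
    (h : ∑ i, min |inner ℝ u (S i).1| (√n / 4) * (inner ℝ u (S i).1) ^ 2 / √n < K * √n) :
    ∑ i, |inner ℝ u (S i).1| ^ 3 ≤ K * n := by
  have hq : 0 < √(n : ℝ) := Real.sqrt_pos.2 (by exact_mod_cast hn)
  have hqq : √(n : ℝ) * √n = n := Real.mul_self_sqrt n.cast_nonneg
  have e : ∀ i, min |inner ℝ u (S i).1| (√n / 4) * (inner ℝ u (S i).1) ^ 2 / √n =
      |inner ℝ u (S i).1| ^ 3 / √n := by
    intro i
    have h9 : |inner ℝ u (S i).1| ≤ √n / 4 := by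
      have := abs_real_inner_le_norm u (S i).1
      rw [hu, one_mul] at this
      exact this.trans (hnorm i)
    rw [min_eq_left h9, ← sq_abs (inner ℝ u (S i).1)]
    ring
  simp only [e, ← Finset.sum_div] at h
  rw [div_lt_iff₀ hq, mul_assoc, hqq] at h
  exact h.le

end Model

/-- A union bound over six events: a long feature, a large truncated cube sum or a small loss
increment on a net, too few large or too few small entries in some coordinate, and a null event. The
first gives the logarithmic term, the next four fit under one bound `Λ ^ d * exp (-(r * √n))`. -/
theorem exists_measureReal_not_satisfiesBounds_le (a b : ℝ) (ha : 0 < a) :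
    ∃ c C Λ r : ℝ, 0 < c ∧ 0 < C ∧ 1 ≤ Λ ∧ 0 < r ∧ ∀ (n d k : ℕ) (lam : ℝ)
      (P : Measure (EuclideanSpace ℝ (Fin d) × ℝ)), GaussianModel a b d lam P → 0 < n →
      Real.log n * √d ≤ √n / 4 → (k : ℝ) ≤ 3 / 32 * n →
      (Measure.pi fun _ : Fin n => P).real {S | ¬ SatisfiesBounds c C 1 k lam S} ≤
        n * (d * (gaussianExpMoment * Real.exp (-(3 / 8 * Real.log n ^ 2)))) +
          4 * (Λ ^ d * Real.exp (-(r * √n))) := by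
  have hm1 := one_le_gaussianExpMoment
  obtain ⟨κ, hκ0, r₀, hr₀, hdrift⟩ := exists_measureReal_pi_sum_lossIncrement_le b
  -- A factor `8` from the net and `2` from the Chernoff level.
  set K := 16 * (64 * gaussianExpMoment) with hK
  have hK2 : 2 ≤ K := by linarith
  obtain ⟨M, hM0, hMB⟩ : ∃ M : ℝ, 0 < M ∧ 2 * K * (b + 1) ^ 3 ≤ 3 / 16 * M ^ 3 := by
    have h1 : Tendsto (fun M : ℝ => 3 / 16 * M ^ 3) atTop atTop :=
      (tendsto_pow_atTop three_ne_zero).const_mul_atTop (by norm_num)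
    obtain ⟨M, h2, h3⟩ := ((h1.eventually_ge_atTop (2 * K * (b + 1) ^ 3)).and
      (eventually_gt_atTop 0)).exists
    exact ⟨M, h3, h2⟩
  have hρ0 : 0 < Real.sigmoid (-M) / 32 := div_pos (Real.sigmoid_pos _) (by norm_num)
  obtain ⟨μ, hμ0, hμ1, hμ⟩ : ∃ μ : ℝ, 0 < μ ∧ μ ≤ 3 / 4 ∧
      μ ≤ (gaussianReal 0 1).real {x | |x| ≤ Real.sigmoid (-M) / 32} :=
    ⟨min (3 / 4) _, lt_min (by norm_num) (gaussianReal_abs_le_pos hρ0), min_le_left _ _,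
      min_le_right _ _⟩
  have hτ : 0 < Real.sigmoid (1 / 8) - 1 / 2 := by
    have := Real.sigmoid_lt (by norm_num : (0 : ℝ) < 1 / 8)
    rw [Real.sigmoid_zero] at this
    linarith
  obtain ⟨c, hc0, hc1, hcLip, hcGrad⟩ : ∃ c : ℝ, 0 < c ∧ c ≤ 1 ∧
      c ≤ 3 / 16 / 2 * ((Real.sigmoid (1 / 8) - 1 / 2) ^ 2 / 64) ∧
      c ≤ √(μ / 4 / 2 * (Real.sigmoid (-M) / 32) ^ 2) :=
    ⟨min 1 (min _ _), lt_min one_pos (lt_min (by positivity) (Real.sqrt_pos.2 (by positivity))),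
      min_le_left _ _, (min_le_right _ _).trans (min_le_left _ _),
      (min_le_right _ _).trans (min_le_right _ _)⟩
  obtain ⟨ε, hε0, hε⟩ : ∃ ε : ℝ, 0 < ε ∧ ε * (1 + K + gaussianExpMoment) ≤ κ := by
    have hden : 0 < 1 + K + gaussianExpMoment := by linarith
    exact ⟨κ / (1 + K + gaussianExpMoment), div_pos hκ0 hden,
      (div_mul_cancel₀ _ hden.ne').le⟩
  -- `5 = 1 + 2 / (1 / 2)` serves the net for the cubes, the other bound the net for the increments.
  obtain ⟨Λ, hΛ5, hΛε⟩ : ∃ Λ : ℝ, 5 ≤ Λ ∧ 1 + 2 / ε ≤ Λ :=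
    ⟨max 5 _, le_max_left _ _, le_max_right _ _⟩
  obtain ⟨r, hr0, hr1, hr2, hr3, hr4⟩ : ∃ r : ℝ, 0 < r ∧ r ≤ 64 * gaussianExpMoment ∧ r ≤ r₀ ∧
      r ≤ 3 / 4 / 4 ∧ r ≤ μ / 4 :=
    ⟨min (64 * gaussianExpMoment) (min r₀ (min (3 / 4 / 4) (μ / 4))), by positivity,
      min_le_left _ _, (min_le_right _ _).trans (min_le_left _ _),
      (min_le_right _ _).trans ((min_le_right _ _).trans (min_le_left _ _)),
      (min_le_right _ _).trans ((min_le_right _ _).trans (min_le_right _ _))⟩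
  refine ⟨c ^ 6, K, Λ, r, by positivity, by linarith, by linarith, hr0,
    fun n d k lam P h hn hlog hk => ?_⟩
  have := h.isProbabilityMeasure
  obtain ⟨θ, hθmin, haθ, hθb⟩ := h.optimum
  have hn1 : (1 : ℝ) ≤ n := by exact_mod_cast hn
  have hsq1 : √(n : ℝ) ≤ n := by
    rw [Real.sqrt_le_left (by linarith)]; nlinarith
  -- The lower bound `a` on the optimum enters here: in dimension `0` there would be no coordinate
  -- along which to test the Hessian.
  have hd : 0 < d := by
    rcases Nat.eq_zero_or_pos d with rfl | hd
    · have : θ = 0 := Subsingleton.elim _ _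
      rw [this, norm_zero] at haθ
      linarith
    · exact hd
  obtain ⟨N₁, hN₁, hN₁c, hN₁card⟩ := exists_net_unitSphere (E := EuclideanSpace ℝ (Fin d))
    (ε := 1 / 2) (by norm_num)
  obtain ⟨N₂, hN₂, hN₂c, hN₂card⟩ := exists_net_unitSphere (E := EuclideanSpace ℝ (Fin d)) hε0
  rw [finrank_euclideanSpace_fin] at hN₁card hN₂card
  have hA₁ := measureReal_pi_exists_le P n {s | Real.log n * √d < ‖s.1‖}
  have hA₁' := mul_le_mul_of_nonneg_left
    (h.measureReal_lt_norm_le (Real.log_natCast_nonneg n)) (n.cast_nonneg (α := ℝ))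
  have hA₂ := measureReal_biUnion_le_card_mul (Measure.pi fun _ : Fin n => P) N₁ _ fun u hu =>
    h.measureReal_pi_sum_truncated_cube (hN₁ u hu) hn
  have hA₃ := measureReal_biUnion_le_card_mul (Measure.pi fun _ : Fin n => P) N₂ _ fun u hu =>
    hdrift a lam d P h θ u hθmin hθb (hN₂ u hu) n
  have hA₄ := h.measureReal_pi_exists_few_large n
  have hA₅ := h.measureReal_pi_exists_few_small n hμ
  have hA₆ := h.measureReal_pi_exists_degenerate ⟨0, hd⟩ n
  have hcount : ∀ (q x y : ℝ), q ≤ Λ ^ d → r ≤ x → √n ≤ y →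
      q * Real.exp (-(y * x)) ≤ Λ ^ d * Real.exp (-(r * √n)) := fun q x y hq hx hy => by
    refine mul_le_mul hq (Real.exp_le_exp.2 (neg_le_neg ?_)) (Real.exp_pos _).le
      (pow_nonneg (by linarith) _)
    rw [mul_comm y]
    exact mul_le_mul hx hy (Real.sqrt_nonneg _) (hr0.le.trans hx)
  have hdΛ : (d : ℝ) ≤ Λ ^ d := by
    have h1 : (d : ℝ) ≤ 2 ^ d := by exact_mod_cast d.lt_two_pow_self.le
    exact h1.trans (pow_le_pow_left₀ (by norm_num) (by linarith) d)
  have hN₁Λ : (N₁.card : ℝ) ≤ Λ ^ d := by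
    refine hN₁card.trans ?_
    norm_num
    exact pow_le_pow_left₀ (by norm_num) hΛ5 d
  have hB₂ := hcount _ _ _ hN₁Λ hr1 le_rfl
  have hB₃ := hcount _ _ _ (hN₂card.trans (pow_le_pow_left₀ (by positivity) hΛε d)) hr2 hsq1
  have hB₄ := hcount _ _ _ hdΛ hr3 hsq1
  have hB₅ := hcount _ _ _ hdΛ hr4 hsq1
  rw [mul_comm (√(n : ℝ))] at hB₂
  refine (measureReal_le_of_union_bound (hA₁.trans hA₁') (hA₂.trans hB₂) (hA₃.trans hB₃)
    (hA₄.trans hB₄) (hA₅.trans hB₅) hA₆ ?_).trans (le_of_eq (by ring))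
  · intro S h1 h2 h3 h4 h5 h6
    refine not_not.2 ?_
    have h1' : ∀ i, ‖(S i).1‖ ≤ Real.log n * √d := fun i =>
      not_lt.1 fun hi => h1 ⟨i, hi⟩
    have h6' : ∀ i, |(S i).2| = 1 ∧ (S i).1 ⟨0, hd⟩ ≠ 0 := fun i =>
      not_not.1 fun hi => h6 ⟨i, hi⟩
    have hcube : ∀ u : EuclideanSpace ℝ (Fin d),
        ∑ i, |inner ℝ u (S i).1| ^ 3 ≤ K * n * ‖u‖ ^ 3 := by
      intro u
      refine (sum_abs_inner_pow_three_le_of_net (A := 2 * (64 * gaussianExpMoment) * n) hN₁c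
        (fun v hv => sum_cube_le_of_truncated hn (fun i => (h1' i).trans hlog) (hN₁ v hv)
          (not_le.1 fun hle => h2 ⟨v, hv, hle⟩)) u).trans (le_of_eq ?_)
      rw [hK]; ring
    have hpos : ∀ u : EuclideanSpace ℝ (Fin d), ‖u‖ = 1 →
        0 < ∑ i, lossIncrement lam θ u (S i) := fun u hu =>
      sum_lossIncrement_pos_of_net h.lam_pos (by linarith) (fun i => (h6' i).1) hcube
        (h.lam_mul_norm_le hθmin) hε hN₂c
        (fun v hv => not_le.1 fun hle => h3 ⟨v, hv, hle⟩) hu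
    have hθ' : ‖trainedModel lam S‖ ≤ b + 1 :=
      (norm_trainedModel_le h.lam_pos hn S θ hpos).trans (by linarith)
    refine satisfiesBounds_of_typical (δ := 3 / 16) (δ' := μ / 4) h.lam_pos hn ⟨0, hd⟩ hK2 hM0
      (by linarith) (by linarith) (by norm_num) hMB (by linarith) hc0.le hc1 hcLip hcGrad
      (fun i => (h6' i).1) (fun i => (h6' i).2) h1' hcube (fun j => ?_) (fun j => ?_) hθ'
    · have := not_le.1 fun hle => h4 ⟨j, hle⟩
      linarith
    · have := not_le.1 fun hle => h5 ⟨j, hle⟩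
      linarith

/-! ### Superpolynomial decay -/

/-- Multiplication by `n ^ q` turns the exponent into `-(log n * (r * log n - q))`, which still
tends to `-∞`. -/
theorem superpolynomialDecay_exp_neg_log_sq {r : ℝ} (hr : 0 < r) :
    SuperpolynomialDecay atTop (fun n : ℕ => (n : ℝ))
      (fun n : ℕ => Real.exp (-(r * Real.log n ^ 2))) := by
  intro q
  have hlog : Tendsto (fun n : ℕ => Real.log n) atTop atTop :=
    Real.tendsto_log_atTop.comp tendsto_natCast_atTop_atTop
  have h1 : Tendsto (fun x : ℝ => x * (r * x - q)) atTop atTop :=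
    tendsto_id.atTop_mul_atTop₀ (tendsto_atTop_add_const_right _ (-(q : ℝ))
      (tendsto_id.const_mul_atTop hr))
  have h2 := Real.tendsto_exp_neg_atTop_nhds_zero.comp (h1.comp hlog)
  refine h2.congr' ?_
  filter_upwards [eventually_gt_atTop 0] with n hn
  have hn' : (0 : ℝ) < n := by exact_mod_cast hn
  simp only [Function.comp_apply]
  conv_rhs => rw [← Real.exp_log hn', ← Real.exp_nat_mul, Real.log_exp, ← Real.exp_add]
  congr 1
  ring

theorem superpolynomialDecay_exp_neg_sqrt {r : ℝ} (hr : 0 < r) :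
    SuperpolynomialDecay atTop (fun n : ℕ => (n : ℝ))
      (fun n : ℕ => Real.exp (-(r * √n))) := by
  intro q
  have hsq : Tendsto (fun n : ℕ => √(n : ℝ)) atTop atTop :=
    Real.tendsto_sqrt_atTop.comp tendsto_natCast_atTop_atTop
  have h1 := (tendsto_rpow_mul_exp_neg_mul_atTop_nhds_zero (2 * q : ℕ) r hr).comp hsq
  refine h1.congr fun n => ?_
  simp only [Function.comp_apply, Real.rpow_natCast]
  rw [pow_mul, Real.sq_sqrt n.cast_nonneg, neg_mul]

theorem eventually_log_mul_sqrt_le {d : ℕ → ℕ}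
    (hd : (fun n => (d n : ℝ)) =o[atTop] (fun n : ℕ => √(n : ℝ))) :
    ∀ᶠ n : ℕ in atTop, Real.log n * √(d n) ≤ √n / 4 := by
  have h1 : ∀ᶠ n : ℕ in atTop, (d n : ℝ) ≤ √n := by
    filter_upwards [hd.bound one_pos] with n hn
    simpa [abs_of_nonneg] using hn
  have h2 : ∀ᶠ x : ℝ in atTop, Real.log x ≤ 1 / 4 * x ^ (1 / 4 : ℝ) := by
    filter_upwards [(isLittleO_log_rpow_atTop (by norm_num : (0 : ℝ) < 1 / 4)).bound
      (by norm_num : (0 : ℝ) < 1 / 4), eventually_ge_atTop 0] with x hx hx0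
    rw [Real.norm_of_nonneg (Real.rpow_nonneg hx0 _)] at hx
    exact (le_abs_self _).trans hx
  filter_upwards [h1, tendsto_natCast_atTop_atTop.eventually h2] with n hn1 hn2
  have hn0 : (0 : ℝ) ≤ n := n.cast_nonneg
  have h3 : √(d n : ℝ) ≤ (n : ℝ) ^ (1 / 4 : ℝ) := by
    refine (Real.sqrt_le_sqrt hn1).trans (le_of_eq ?_)
    rw [Real.sqrt_eq_rpow, Real.sqrt_eq_rpow, ← Real.rpow_mul hn0]
    norm_num
  have h4 : √(n : ℝ) = (n : ℝ) ^ (1 / 4 : ℝ) * (n : ℝ) ^ (1 / 4 : ℝ) := by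
    rw [Real.sqrt_eq_rpow, ← Real.rpow_add' hn0 (by norm_num)]
    norm_num
  have h5 := mul_le_mul hn2 h3 (Real.sqrt_nonneg _) (by positivity)
  rw [h4]
  linarith

theorem eventually_pow_le_exp_sqrt {d : ℕ → ℕ}
    (hd : (fun n => (d n : ℝ)) =o[atTop] (fun n : ℕ => √(n : ℝ))) {Λ r : ℝ} (hΛ : 1 ≤ Λ)
    (hr : 0 < r) : ∀ᶠ n : ℕ in atTop, Λ ^ d n ≤ Real.exp (r * √n) := by
  have hl := Real.log_nonneg hΛ
  -- The added `1` avoids division by zero when `Λ = 1`.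
  filter_upwards [hd.bound (by positivity : 0 < r / (Real.log Λ + 1))] with n hn
  rw [Real.norm_natCast, Real.norm_of_nonneg (Real.sqrt_nonneg _), div_mul_eq_mul_div,
    le_div_iff₀ (by positivity)] at hn
  rw [← Real.exp_log (by linarith : 0 < Λ), ← Real.exp_nat_mul, Real.exp_le_exp]
  linarith [(Nat.cast_nonneg (d n) : (0 : ℝ) ≤ d n)]

end GaussLogReg

end

/-! ### From the bound at fixed `n` to sequences -/

theorem mainTheorem5 (a b : ℝ) (ha : 0 < a) (hab : a ≤ b) :
    ∃ c C : ℝ, 0 < c ∧ 0 < C ∧ ∃ p : ℕ,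
      ∀ (d k : ℕ → ℕ) (lam : ℕ → ℝ)
        (P : ∀ n : ℕ, Measure (EuclideanSpace ℝ (Fin (d n)) × ℝ)),
        (fun n => (d n : ℝ)) =o[atTop] (fun n : ℕ => Real.sqrt n) →
        (fun n => (k n : ℝ)) =o[atTop] (fun n : ℕ => Real.sqrt n) →
        (∀ n, GaussLogReg.GaussianModel a b (d n) (lam n) (P n)) →
        SuperpolynomialDecay atTop (fun n : ℕ => (n : ℝ)) (fun n : ℕ =>
          (Measure.pi fun _ : Fin n => P n).real
            {S | ¬ (
              c * ((k n : ℝ) ^ 2 * d n / ((n : ℝ) ^ 2 * lam n ^ 3)) ≤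
                  GaussLogReg.averageExistingBound (lam n) S (k n) ∧
              (∀ T : Finset (Fin n), T.card = k n →
                (c * n ≤ GaussLogReg.cLip (lam n) S T ∧
                  GaussLogReg.cLip (lam n) S T ≤ C * n) ∧
                (c * (1 / (lam n * n)) ≤ GaussLogReg.cOp (lam n) S T ∧
                  GaussLogReg.cOp (lam n) S T ≤ C * (1 / (lam n * n)))) ∧
              c * Real.sqrt (d n) ≤ GaussLogReg.cGrad (lam n) S ∧
              GaussLogReg.cGrad (lam n) S ≤ C * Real.log n ^ p * Real.sqrt (d n))}) := by
  obtain ⟨c, C, Λ, r, hc, hC, hΛ, hr, hmain⟩ :=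
    GaussLogReg.exists_measureReal_not_satisfiesBounds_le a b ha
  refine ⟨c, C, hc, hC, 1, fun d k lam P hd hk hP => ?_⟩
  have h1 : SuperpolynomialDecay atTop (fun n : ℕ => (n : ℝ)) (fun n : ℕ =>
      (n : ℝ) ^ 2 * (Real.exp (-(3 / 8 * Real.log n ^ 2)) * GaussLogReg.gaussianExpMoment) +
        Real.exp (-(r / 2 * √n)) * 4) :=
    (((GaussLogReg.superpolynomialDecay_exp_neg_log_sq (by norm_num)).mul_const _).param_pow_mul
      2).add ((GaussLogReg.superpolynomialDecay_exp_neg_sqrt (by linarith)).mul_const 4)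
  refine h1.trans_eventually_abs_le ?_
  -- Half of the exponent `r * √n` absorbs `Λ ^ d`, and the other half is the decay that remains.
  -- The bound `d ≤ √n ≤ n` turns the factor `n * d` into `n ^ 2`.
  filter_upwards [eventually_gt_atTop 0, GaussLogReg.eventually_log_mul_sqrt_le hd,
    GaussLogReg.eventually_pow_le_exp_sqrt hd hΛ (half_pos hr), hd.bound one_pos,
    hk.bound (by norm_num : (0 : ℝ) < 3 / 32)] with n hn hlog hpow hdn hkn
  have hn1 : (1 : ℝ) ≤ n := by exact_mod_cast hn
  have hsq1 : √(n : ℝ) ≤ n := by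
    rw [Real.sqrt_le_left (by linarith)]; nlinarith
  rw [Real.norm_natCast, Real.norm_of_nonneg (Real.sqrt_nonneg _)] at hdn hkn
  have hb := hmain n (d n) (k n) (lam n) (P n) (hP n) hn hlog (by linarith)
  simp only [Function.comp_apply]
  rw [abs_of_nonneg measureReal_nonneg]
  refine le_trans hb (le_trans ?_ (le_abs_self _))
  have hm := GaussLogReg.one_le_gaussianExpMoment
  have e1 : (n : ℝ) * (d n * (GaussLogReg.gaussianExpMoment *
      Real.exp (-(3 / 8 * Real.log n ^ 2)))) ≤
      (n : ℝ) ^ 2 * (Real.exp (-(3 / 8 * Real.log n ^ 2)) * GaussLogReg.gaussianExpMoment) := by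
    rw [sq (n : ℝ), mul_assoc (n : ℝ), mul_comm (Real.exp _)]
    exact mul_le_mul_of_nonneg_left (mul_le_mul_of_nonneg_right (by linarith) (by positivity))
      n.cast_nonneg
  have e2 : Λ ^ d n * Real.exp (-(r * √n)) ≤ Real.exp (-(r / 2 * √n)) := by
    refine (mul_le_mul_of_nonneg_right hpow (Real.exp_pos _).le).trans (le_of_eq ?_)
    rw [← Real.exp_add]
    congr 1
    ring
  linarith
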